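/- Let $[n]=\{0,\dots,n\}$, and let $X\subseteq 2^{[n]}$ be a simplicial complex: $X$ is closed under passing to subsets and $\emptyset\in X$; elements of $[n]$ need not be vertices. Put $P=\mathbb C[x_0,\dots,x_n]$, $x^p=\prod_{i\in p}x_i$ for $p\subseteq[n]$, $I_X=\langle x^p : p\notin X\rangle$ and $A_X=P/I_X$, all graded by $\mathbb Z^{n+1}$ with $\deg x_i$ the $i$-th unit vector. Let $T^1$ be the cokernel of $\mathrm{Der}_{\mathbb C}(P,P)\to\mathrm{Hom}_P(I_X,A_X)$. Let $j:F=P^{\{p\subseteq[n]\,:\,p\notin X\}}\to P$ be given by $e_p\mapsto x^p$, with $\deg e_p$ the characteristic vector of $p$. Put $R=\ker j$, let $R_0\subseteq R$ be the submodule generated by the Koszul relations $j(u)v-j(v)u$ $(u,v\in F)$, and let $T^2$ be the cokernel of the map $\mathrm{Hom}_P(F,A_X)\to\mathrm{Hom}_{A_X}(R/R_0,A_X)$ induced by restriction. A subscript $\mathbf c\in\mathbb Z^{n+1}$ denotes the homogeneous part of degree $\mathbf c$. The *trivial deformations* in $\mathrm{Hom}_P(I_X,A_X)_{\mathbf c}$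 are the elements whose class in $T^1$ is $0$. Let $\mathbf a\in\mathbb N^{n+1}$ have support $a$, let $b\subseteq[n]$ be disjoint from $a$ (in particular $a,b\in X$ is allowed, but not required), and let $\mathbf c=\mathbf a-b$, where $b$ is identified with its characteristic vector. Define $$N_{a-b}=\{f\in X : a\subseteq f,\ f\cap b=\emptyset,\ f\cup b\notin X\},$$ $$\widetilde N_{a-b}=\{f\in N_{a-b} : f\cup b'\notin X\text{ for some proper subset } b'\subsetneq b\}.$$ A subset $Y\subseteq X$ is a *U subset* if $f,g\in Y$ and $f\cup g\in X$ imply $f\cup g\in Y$; both $N_{a-b}$ and $\widetilde N_{a-b}$ are U subsets. For a U subset $Y$ and $k\ge0$ let $Y^{(k)}=\{(f_0,\dots,f_k)\in Y^{k+1} : f_0\cup\dots\cup f_k\in Y\}$, and let $K^k(Y)$ be the space of alternating functions $\lambda:Y^{(k)}\to\mathbb C$. With $(d\lambda)(f_0,\dots,f_k)=\sum_{v=0}^k(-1)^v\lambda(f_0,\dots,\widehat{f_v},\dots,f_k)$ these form a complex $K^\bullet(Y)$ in degrees $k\ge 0$. Then restriction of functions is a surjection of complexes $K^\bullet(N_{a-b})\to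 K^\bullet(\widetilde N_{a-b})$, and there are isomorphisms of complex vector spaces $$\mathrm{Hom}_P(I_X,A_X)_{\mathbf c}\;\cong\; H^0\big(\ker(K^\bullet(N_{a-b})\to K^\bullet(\widetilde N_{a-b}))\big),$$ $$T^2_{\mathbf c}\;\cong\; H^1\big(\ker(K^\bullet(N_{a-b})\to K^\bullet(\widetilde N_{a-b}))\big).$$ Moreover, the trivial deformations in $\mathrm{Hom}_P(I_X,A_X)_{\mathbf c}$ form a one-dimensional subspace if $\#b=1$ and $N_{a-b}\neq\emptyset$, and they are $0$ in all other cases. -/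

import Mathlib

noncomputable section

/-! ### Cotangent modules of a presented algebra

`S` is a `ℂ`-algebra (a polynomial ring in the application), `g : ι → S` a family of
generators of the ideal `I`, and `A = S / I`. -/

namespace Cotangent

variable {S : Type*} [CommRing S]

/-- The natural map `Der_ℂ(S, S) → Hom_S(I, S / I)`, `D ↦ (x ↦ D x mod I)`. -/
def derToHom [Algebra ℂ S] (I : Ideal S) : Derivation ℂ S S →ₗ[S] (I →ₗ[S] (S ⧸ I)) where
  toFun D :=
    { toFun := fun x => Submodule.mkQ I (D (x : S))
      map_add' := fun x y => by simp
      map_smul' := fun f x => by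
        have h : Submodule.mkQ I ((x : S) * D f) = 0 := by
          rw [Submodule.mkQ_apply, Submodule.Quotient.mk_eq_zero]
          exact I.mul_mem_right _ x.2
        have h2 : D ((f • x : I) : S) = f • D (x : S) + (x : S) * D f := by
          simp
        rw [h2, map_add, h, add_zero, map_smul, RingHom.id_apply] }
  map_add' D E := by ext x; simp
  map_smul' f D := by ext x; rfl

/-- `T¹` of `S / I`: the cokernel of `Der_ℂ(S, S) → Hom_S(I, S / I)`. -/
abbrev T1 [Algebra ℂ S] (I : Ideal S) : Type _ := (I →ₗ[S] (S ⧸ I)) ⧸ LinearMap.range (derToHom I)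

variable {ι : Type*} [Fintype ι]

/-- The map `j` from the free module on `ι` to `S` with `e_p ↦ g p`; its image is `(g)`. -/
abbrev pres (g : ι → S) : (ι → S) →ₗ[S] S := Fintype.linearCombination S g

/-- The module `R` of relations, the kernel of `j`. -/
abbrev Rel (g : ι → S) : Submodule S (ι → S) := LinearMap.ker (pres g)

/-- The submodule `R₀ ⊆ R` of Koszul relations, spanned by the `j(u) v - j(v) u`. -/
def koszul (g : ι → S) : Submodule S (Rel g) :=
  Submodule.span S {r | ∃ u v : ι → S, (r : ι → S) = pres g u • v - pres g v • u}

/-- `Hom(R / R₀, A)` with `A = S / (g)`. As `S → A` is onto and `R / R₀` and `A` are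
`A`-modules, the `S`-linear maps are the `A`-linear maps. -/
abbrev RelHom (g : ι → S) : Type _ :=
  (Rel g ⧸ koszul g) →ₗ[S] (S ⧸ Ideal.span (Set.range g))

theorem pres_mem (g : ι → S) (u : ι → S) : pres g u ∈ Ideal.span (Set.range g) := by
  have h : pres g u ∈ LinearMap.range (pres g) := ⟨u, rfl⟩
  rwa [Fintype.range_linearCombination] at h

theorem koszul_le (g : ι → S) (φ : (ι → S) →ₗ[S] (S ⧸ Ideal.span (Set.range g))) :
    koszul g ≤ LinearMap.ker (φ ∘ₗ (Rel g).subtype) := by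
  have key : ∀ (s : S) (x : S ⧸ Ideal.span (Set.range g)),
      s ∈ Ideal.span (Set.range g) → s • x = 0 := by
    intro s x hs
    obtain ⟨y, rfl⟩ := Submodule.mkQ_surjective _ x
    rw [← map_smul, Submodule.mkQ_apply, Submodule.Quotient.mk_eq_zero]
    exact Ideal.mul_mem_right _ _ hs
  refine Submodule.span_le.2 ?_
  rintro r ⟨u, v, h⟩
  simp only [SetLike.mem_coe, LinearMap.mem_ker, LinearMap.comp_apply, Submodule.subtype_apply]
  rw [h, map_sub, map_smul, map_smul, key _ _ (pres_mem g u), key _ _ (pres_mem g v), sub_zero]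

/-- The map `Hom_S(S^ι, A) → Hom_A(R / R₀, A)` given by restriction to `R`. -/
def relRestrict (g : ι → S) :
    ((ι → S) →ₗ[S] (S ⧸ Ideal.span (Set.range g))) →ₗ[S] RelHom g where
  toFun φ := (koszul g).liftQ (φ ∘ₗ (Rel g).subtype) (koszul_le g φ)
  map_add' φ ψ := by ext x; simp
  map_smul' f φ := by ext x; simp

/-- `T²` of `S / (g)`: the cokernel of `Hom_S(S^ι, A) → Hom_A(R / R₀, A)`. -/
abbrev T2 (g : ι → S) : Type _ := RelHom g ⧸ LinearMap.range (relRestrict g)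

end Cotangent

/-! ### Simplicial complexes and U subsets -/

/-- A simplicial complex on `[n] = {0, …, n}`. The empty set is a face, and elements of `[n]`
need not be vertices. -/
structure FaceComplex (n : ℕ) where
  faces : Set (Finset (Fin (n + 1)))
  empty_mem : ∅ ∈ faces
  down_closed : ∀ ⦃f g : Finset (Fin (n + 1))⦄, f ∈ faces → g ⊆ f → g ∈ faces

namespace FaceComplex

variable {n : ℕ} (X : FaceComplex n)

/-- A U subset `Y` of `X`: if `f, g ∈ Y` and `f ∪ g ∈ X`, then `f ∪ g ∈ Y`. -/
structure USubset where
  carrier : Set (Finset (Fin (n + 1)))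
  subset : carrier ⊆ X.faces
  union_mem : ∀ ⦃f g : Finset (Fin (n + 1))⦄,
    f ∈ carrier → g ∈ carrier → f ∪ g ∈ X.faces → f ∪ g ∈ carrier

/-- `N_{a-b}`: the faces `f ⊇ a` with `f ∩ b = ∅` and `f ∪ b ∉ X`. -/
def N (a b : Finset (Fin (n + 1))) : X.USubset where
  carrier := {f | f ∈ X.faces ∧ a ⊆ f ∧ f ∩ b = ∅ ∧ f ∪ b ∉ X.faces}
  subset := fun _ hf => hf.1
  union_mem := by
    rintro f g ⟨_, hf2, hf3, hf4⟩ ⟨_, _, hg3, _⟩ hfg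
    refine ⟨hfg, hf2.trans Finset.subset_union_left, ?_, fun h => hf4 (X.down_closed h ?_)⟩
    · rw [Finset.union_inter_distrib_right, hf3, hg3, Finset.union_empty]
    · exact Finset.union_subset_union_left Finset.subset_union_left

/-- `Ñ_{a-b}`: those `f ∈ N_{a-b}` with `f ∪ b' ∉ X` for some proper subset `b'` of `b`. -/
def NTilde (a b : Finset (Fin (n + 1))) : X.USubset where
  carrier := {f | f ∈ (X.N a b).carrier ∧ ∃ b' : Finset (Fin (n + 1)), b' ⊂ b ∧ f ∪ b' ∉ X.faces}
  subset := fun _ hf => (X.N a b).subset hf.1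
  union_mem := by
    rintro f g ⟨hf, b', hb', hfb⟩ ⟨hg, _⟩ hfg
    refine ⟨(X.N a b).union_mem hf hg hfg, b', hb', fun h => hfb (X.down_closed h ?_)⟩
    exact Finset.union_subset_union_left Finset.subset_union_left

theorem NTilde_subset_N (a b : Finset (Fin (n + 1))) :
    (X.NTilde a b).carrier ⊆ (X.N a b).carrier := fun _ hf => hf.1

variable {X}

theorem USubset.sup_mem (Y : X.USubset) {k : ℕ} (f : Fin (k + 1) → Finset (Fin (n + 1)))
    (hf : ∀ i, f i ∈ Y.carrier) (h : Finset.univ.sup f ∈ X.faces) :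
    Finset.univ.sup f ∈ Y.carrier := by
  have key : ∀ s : Finset (Fin (k + 1)), s.Nonempty → s.sup f ∈ Y.carrier := by
    intro s hs
    induction hs using Finset.Nonempty.cons_induction with
    | singleton i => simpa using hf i
    | cons i s hi hs ih =>
      rw [Finset.sup_cons]
      refine Y.union_mem (hf i) ih (X.down_closed h ?_)
      have := Finset.sup_mono (f := f) (Finset.subset_univ (Finset.cons i s hi))
      rwa [Finset.sup_cons] at this
  exact key _ Finset.univ_nonempty

/-! ### The complex `K^•(Y)` of a U subset -/

namespace USubset

/-- `Y^{(k)}`: the tuples `(f_0, …, f_k)` in `Y` with `f_0 ∪ … ∪ f_k ∈ Y`. -/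
def Tuple (Y : X.USubset) (k : ℕ) : Type :=
  {f : Fin (k + 1) → Finset (Fin (n + 1)) //
    (∀ i, f i ∈ Y.carrier) ∧ Finset.univ.sup f ∈ Y.carrier}

variable {Y Z : X.USubset} {k : ℕ}

/-- `(f_0, …, f_k) ↦ (f_{σ 0}, …, f_{σ k})`. -/
def Tuple.perm (f : Y.Tuple k) (σ : Equiv.Perm (Fin (k + 1))) : Y.Tuple k :=
  ⟨f.1 ∘ σ, fun i => f.2.1 (σ i), by
    have h : Finset.univ.sup (f.1 ∘ σ) = Finset.univ.sup f.1 := by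
      rw [← Finset.sup_image, Finset.image_univ_equiv]
    rw [h]; exact f.2.2⟩

/-- `(f_0, …, f_{k+1}) ↦ (f_0, …, f_v omitted, …, f_{k+1})`. -/
def Tuple.face (f : Y.Tuple (k + 1)) (v : Fin (k + 2)) : Y.Tuple k :=
  ⟨fun i => f.1 (v.succAbove i), fun _ => f.2.1 _,
    Y.sup_mem _ (fun _ => f.2.1 _) (X.down_closed (Y.subset f.2.2)
      (Finset.sup_le fun i _ => Finset.le_sup (f := f.1) (Finset.mem_univ (v.succAbove i))))⟩

/-- A tuple in a U subset `Z ⊆ Y` as a tuple in `Y`. -/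
def Tuple.incl (h : Z.carrier ⊆ Y.carrier) (f : Z.Tuple k) : Y.Tuple k :=
  ⟨f.1, fun i => h (f.2.1 i), h f.2.2⟩

variable (Y) in
/-- `K^k(Y)`: the alternating functions `Y^{(k)} → ℂ`. -/
def K (k : ℕ) : Submodule ℂ (Y.Tuple k → ℂ) where
  carrier := {l | ∀ (f : Y.Tuple k) (σ : Equiv.Perm (Fin (k + 1))),
    l (f.perm σ) = ((Equiv.Perm.sign σ : ℤ) : ℂ) * l f}
  add_mem' := by
    intro l m hl hm f σ
    rw [Pi.add_apply, Pi.add_apply, hl f σ, hm f σ, mul_add]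
  zero_mem' := by intro f σ; simp
  smul_mem' := by
    intro c l hl f σ
    rw [Pi.smul_apply, Pi.smul_apply, hl f σ, smul_eq_mul, smul_eq_mul, mul_left_comm]

variable (Y) in
/-- The formula `(dλ)(f_0, …, f_{k+1}) = ∑_v (-1)^v λ(f_0, …, f_v omitted, …, f_{k+1})`. -/
def dFun (k : ℕ) : (Y.Tuple k → ℂ) →ₗ[ℂ] (Y.Tuple (k + 1) → ℂ) where
  toFun l f := ∑ v : Fin (k + 2), (-1) ^ (v : ℕ) * l (f.face v)
  map_add' l m := by
    funext f; simp [mul_add, Finset.sum_add_distrib]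
  map_smul' c l := by
    funext f; simp [Finset.mul_sum, mul_left_comm]

theorem Tuple.perm_mul (f : Y.Tuple k) (σ τ : Equiv.Perm (Fin (k + 1))) :
    f.perm (σ * τ) = (f.perm σ).perm τ := rfl

theorem mem_K_of_swap {l : Y.Tuple k → ℂ}
    (h : ∀ (i : Fin k) (f : Y.Tuple k), l (f.perm (Equiv.swap i.castSucc i.succ)) = -l f) :
    l ∈ Y.K k := by
  intro f σ
  have hσ : σ ∈ Submonoid.closure
      (Set.range fun i : Fin k => Equiv.swap i.castSucc i.succ) := by
    rw [Equiv.Perm.mclosure_swap_castSucc_succ]; trivial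
  induction hσ using Submonoid.closure_induction generalizing f with
  | mem σ hs =>
    obtain ⟨i, rfl⟩ := hs
    simp only
    rw [h, Equiv.Perm.sign_swap (Fin.castSucc_lt_succ).ne]
    simp
  | one => 
    have : f.perm 1 = f := rfl
    simp [this]
  | mul σ τ _ _ h1 h2 =>
    rw [Tuple.perm_mul, h2, h1, Equiv.Perm.sign_mul]
    push_cast
    ring

theorem swap_eq {l : Y.Tuple k → ℂ} (hl : l ∈ Y.K k) (f : Y.Tuple k) {i j : Fin (k + 1)}
    (hij : i ≠ j) : l (f.perm (Equiv.swap i j)) = -l f := by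
  rw [hl, Equiv.Perm.sign_swap hij]; simp

theorem dFun_mem {l : Y.Tuple k → ℂ} (hl : l ∈ Y.K k) : Y.dFun k l ∈ Y.K (k + 1) := by
  refine mem_K_of_swap fun i f => ?_
  change ∑ v : Fin (k + 2), (-1) ^ (v : ℕ) * l ((f.perm _).face v) =
    -∑ v : Fin (k + 2), (-1) ^ (v : ℕ) * l (f.face v)
  rw [← Equiv.sum_comp (Equiv.swap i.castSucc i.succ)
    (fun v : Fin (k + 2) => (-1) ^ (v : ℕ) * l (f.face v)), ← Finset.sum_neg_distrib]
  refine Finset.sum_congr rfl fun v _ => ?_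
  by_cases h1 : v = i.castSucc
  · subst h1
    have h : (f.perm (Equiv.swap i.castSucc i.succ)).face i.castSucc = f.face i.succ := by
      refine Subtype.ext (funext fun j => congrArg f.1 ?_)
      by_cases hj : j = i
      · subst hj; simp
      · have e : i.castSucc.succAbove j = i.succ.succAbove j := by
          ext; simp only [Fin.succAbove, Fin.lt_def, Fin.val_castSucc, Fin.val_succ]
          split_ifs <;> simp <;> omega
        rw [e]
        exact Equiv.swap_apply_of_ne_of_ne (e ▸ Fin.succAbove_ne _ _) (Fin.succAbove_ne _ _)
    rw [h, Equiv.swap_apply_left]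
    simp [pow_succ]
  by_cases h2 : v = i.succ
  · subst h2
    have h : (f.perm (Equiv.swap i.castSucc i.succ)).face i.succ = f.face i.castSucc := by
      refine Subtype.ext (funext fun j => congrArg f.1 ?_)
      by_cases hj : j = i
      · subst hj; simp
      · have e : i.castSucc.succAbove j = i.succ.succAbove j := by
          ext; simp only [Fin.succAbove, Fin.lt_def, Fin.val_castSucc, Fin.val_succ]
          split_ifs <;> simp <;> omega
        rw [← e]
        exact Equiv.swap_apply_of_ne_of_ne (Fin.succAbove_ne _ _) (e ▸ Fin.succAbove_ne _ _)
    rw [h, Equiv.swap_apply_right]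
    simp [pow_succ]
  · rw [Equiv.swap_apply_of_ne_of_ne h1 h2]
    obtain ⟨p, hp⟩ := Fin.exists_succAbove_eq (Ne.symm h1)
    obtain ⟨q, hq⟩ := Fin.exists_succAbove_eq (Ne.symm h2)
    have hpq : p ≠ q := by
      rintro rfl
      exact (Fin.castSucc_lt_succ (i := i)).ne (hp.symm.trans hq)
    have h : (f.perm (Equiv.swap i.castSucc i.succ)).face v
        = (f.face v).perm (Equiv.swap p q) := by
      refine Subtype.ext (funext fun j => congrArg f.1 ?_)
      rw [← hp, ← hq]
      exact Function.Injective.swap_apply Fin.succAbove_right_injective p q j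
    rw [h, swap_eq hl _ hpq, mul_neg]

theorem dFun_dFun (l : Y.Tuple k → ℂ) : Y.dFun (k + 1) (Y.dFun k l) = 0 := by
  funext f
  change ∑ v : Fin (k + 3), (-1) ^ (v : ℕ) *
    (∑ w : Fin (k + 2), (-1) ^ (w : ℕ) * l ((f.face v).face w)) = 0
  simp only [Finset.mul_sum]
  rw [← Finset.sum_product' Finset.univ Finset.univ
    (fun (v : Fin (k + 3)) (w : Fin (k + 2)) =>
      (-1 : ℂ) ^ (v : ℕ) * ((-1) ^ (w : ℕ) * l ((f.face v).face w)))]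
  refine Finset.sum_involution (fun x _ => (x.1.succAbove x.2, x.2.predAbove x.1)) ?_ ?_ ?_ ?_
  · rintro ⟨v, w⟩ _
    have h : (f.face (v.succAbove w)).face (w.predAbove v) = (f.face v).face w :=
      Subtype.ext (funext fun j =>
        congrArg f.1 (Fin.succAbove_succAbove_succAbove_predAbove v w j))
    simp only [h, ← mul_assoc, ← pow_add, Fin.neg_one_pow_succAbove_add_predAbove]
    ring
  · rintro ⟨v, w⟩ _ _ h
    exact Fin.succAbove_ne v w (congrArg Prod.fst h)
  · intro _ _; simp
  · rintro ⟨v, w⟩ _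
    simp [Fin.succAbove_succAbove_predAbove, Fin.predAbove_predAbove_succAbove]

variable (Y) in
/-- The differential `d : K^k(Y) → K^{k+1}(Y)`. -/
def d (k : ℕ) : Y.K k →ₗ[ℂ] Y.K (k + 1) :=
  (Y.dFun k).restrict fun _ hl => dFun_mem hl

theorem d_d (l : Y.K k) : Y.d (k + 1) (Y.d k l) = 0 := Subtype.ext (dFun_dFun l.1)

/-- Restriction of functions from `Y^{(k)}` to `Z^{(k)}`, where `Z ⊆ Y`. -/
def restrFun (h : Z.carrier ⊆ Y.carrier) (k : ℕ) : (Y.Tuple k → ℂ) →ₗ[ℂ] (Z.Tuple k → ℂ) :=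
  LinearMap.funLeft ℂ ℂ (Tuple.incl h)

/-- The canonical map of complexes `K^•(Y) → K^•(Z)` for U subsets `Z ⊆ Y`, in degree `k`. -/
def restr (h : Z.carrier ⊆ Y.carrier) (k : ℕ) : Y.K k →ₗ[ℂ] Z.K k :=
  (restrFun h k).restrict fun _ hl f σ => hl (f.incl h) σ

theorem restr_d (h : Z.carrier ⊆ Y.carrier) (l : Y.K k) :
    restr h (k + 1) (Y.d k l) = Z.d k (restr h k l) := rfl

/-! ### The kernel complex `ker (K^•(Y) → K^•(Z))` and its cohomology

The terms are written as spaces of functions on `Y^{(k)}`. -/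

/-- The degree `k` term of `ker (K^•(Y) → K^•(Z))`: alternating functions on `Y^{(k)}` that
vanish on `Z^{(k)}`. -/
def kerK (h : Z.carrier ⊆ Y.carrier) (k : ℕ) : Submodule ℂ (Y.Tuple k → ℂ) :=
  Y.K k ⊓ LinearMap.ker (restrFun h k)

theorem kerK_eq (h : Z.carrier ⊆ Y.carrier) (k : ℕ) :
    kerK h k = (LinearMap.ker (restr h k)).map (Y.K k).subtype := by
  ext l
  constructor
  · rintro ⟨h1, h2⟩
    exact ⟨⟨l, h1⟩, Subtype.ext h2, rfl⟩
  · rintro ⟨m, hm, rfl⟩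
    exact ⟨m.2, congrArg Subtype.val hm⟩

theorem dFun_mem_kerK (h : Z.carrier ⊆ Y.carrier) {l : Y.Tuple k → ℂ} (hl : l ∈ kerK h k) :
    Y.dFun k l ∈ kerK h (k + 1) := by
  refine ⟨dFun_mem hl.1, ?_⟩
  have e : restrFun h (k + 1) (Y.dFun k l) = Z.dFun k (restrFun h k l) := rfl
  have e2 : restrFun h k l = 0 := hl.2
  change restrFun h (k + 1) (Y.dFun k l) = 0
  rw [e, e2, map_zero]

/-- The cocycles of degree `k` of the kernel complex. -/
def cocycles (h : Z.carrier ⊆ Y.carrier) (k : ℕ) : Submodule ℂ (Y.Tuple k → ℂ) :=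
  kerK h k ⊓ LinearMap.ker (Y.dFun k)

/-- The coboundaries of degree `k` of the kernel complex, which starts in degree `0`. -/
def coboundaries (h : Z.carrier ⊆ Y.carrier) : (k : ℕ) → Submodule ℂ (Y.Tuple k → ℂ)
  | 0 => ⊥
  | k + 1 => (kerK h k).map (Y.dFun k)

theorem coboundaries_le (h : Z.carrier ⊆ Y.carrier) :
    ∀ k : ℕ, coboundaries h k ≤ cocycles h k
  | 0 => bot_le
  | k + 1 => by
    rintro _ ⟨l, hl, rfl⟩
    exact ⟨dFun_mem_kerK h hl, dFun_dFun l⟩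

/-- `H^k (ker (K^•(Y) → K^•(Z)))`, cocycles modulo coboundaries. -/
abbrev H (h : Z.carrier ⊆ Y.carrier) (k : ℕ) : Type :=
  cocycles h k ⧸ (coboundaries h k).submoduleOf (cocycles h k)

end USubset

/-! ### The Stanley-Reisner ring and its graded modules -/

/-- The polynomial ring `P = ℂ[x_0, …, x_n]`. -/
abbrev P (n : ℕ) : Type := MvPolynomial (Fin (n + 1)) ℂ

variable (X)

/-- The nonfaces `p ∈ Δ_n ∖ X`. -/
abbrev Nonface : Type := {p : Finset (Fin (n + 1)) // p ∉ X.faces}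

instance : Fintype X.Nonface := Fintype.ofFinite _

/-- The generators `x^p`, `p ∈ Δ_n ∖ X`, of `I_X`. -/
def gen (p : X.Nonface) : P n := ∏ i ∈ p.1, MvPolynomial.X i

/-- The ideal `I_X`. -/
abbrev I : Ideal (P n) := Ideal.span (Set.range X.gen)

/-- The Stanley-Reisner ring `A_X = P / I_X`. -/
abbrev A : Type := P n ⧸ X.I

/-- The characteristic vector of `p ⊆ [n]`. -/
def char (p : Finset (Fin (n + 1))) : Fin (n + 1) → ℤ := fun i => if i ∈ p then 1 else 0

/-- The homogeneous part `P_d`, `d ∈ ℤ^{n+1}`, for the fine grading `deg x_i = e_i`. -/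
def gradedP (d : Fin (n + 1) → ℤ) : Submodule ℂ (P n) :=
  MvPolynomial.weightedHomogeneousSubmodule ℂ (fun i => (Pi.single i 1 : Fin (n + 1) → ℤ)) d

/-- The homogeneous part `A_{X,d}`, the image of `P_d`. -/
def gradedA (d : Fin (n + 1) → ℤ) : Submodule ℂ X.A :=
  (gradedP d).map ((Submodule.mkQ X.I).restrictScalars ℂ)

/-- `Hom(I_X, A_X)_c`: the `φ` that map elements of degree `d` to elements of degree `d + c`. -/
def homDeg (c : Fin (n + 1) → ℤ) : Submodule ℂ (X.I →ₗ[P n] X.A) where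
  carrier := {φ | ∀ (d : Fin (n + 1) → ℤ) (x : X.I), (x : P n) ∈ gradedP d →
    φ x ∈ X.gradedA (d + c)}
  add_mem' h1 h2 d x hx := Submodule.add_mem _ (h1 d x hx) (h2 d x hx)
  zero_mem' _ _ _ := Submodule.zero_mem _
  smul_mem' s _ h d x hx := Submodule.smul_mem _ s (h d x hx)

/-- The trivial deformations inside `Hom(I_X, A_X)_c`: the elements yielding `0` in `T¹`. -/
def trivialDeg (c : Fin (n + 1) → ℤ) : Submodule ℂ (X.I →ₗ[P n] X.A) :=
  X.homDeg c ⊓ (LinearMap.ker (Submodule.mkQ _ :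
    (X.I →ₗ[P n] X.A) →ₗ[P n] Cotangent.T1 X.I)).restrictScalars ℂ

/-- The relation `r ∈ R ⊆ P^{Δ_n ∖ X}` is homogeneous of degree `d`, where `deg e_p = p`. -/
def RelDeg (d : Fin (n + 1) → ℤ) (r : Cotangent.Rel X.gen) : Prop :=
  ∀ p : X.Nonface, (r : X.Nonface → P n) p ∈ gradedP (d - char p.1)

/-- The degree `c` part of `Hom_A(R / R₀, A_X)`. -/
def relHomDeg (c : Fin (n + 1) → ℤ) : Submodule ℂ (Cotangent.RelHom X.gen) where
  carrier := {ψ | ∀ (d : Fin (n + 1) → ℤ) (r : Cotangent.Rel X.gen), X.RelDeg d r →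
    ψ (Submodule.Quotient.mk r) ∈ X.gradedA (d + c)}
  add_mem' h1 h2 d r hr := Submodule.add_mem _ (h1 d r hr) (h2 d r hr)
  zero_mem' _ _ _ := Submodule.zero_mem _
  smul_mem' s _ h d r hr := Submodule.smul_mem _ s (h d r hr)

/-- `T²_c(X)`: the homogeneous part of degree `c` of `T²` of `A_X`, the image of the
degree `c` part of `Hom_A(R / R₀, A_X)`. -/
def T2Deg (c : Fin (n + 1) → ℤ) : Submodule ℂ (Cotangent.T2 X.gen) :=
  (X.relHomDeg c).map
    ((LinearMap.range (Cotangent.relRestrict X.gen)).mkQ.restrictScalars ℂ)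

end FaceComplex

end

noncomputable section

namespace FaceComplex

open MvPolynomial USubset

/-! ### Exponents, monomials of `I_X`, and coefficients in `A_X`. -/

section

variable {n : ℕ}

/-! Every fine-graded piece of `A_X` has dimension at most one, so a map of degree a - b is a table
of scalars: the value at an element of degree m is a multiple of x^{m+a-b}. The scalar matters only
if that monomial exists and is nonzero (`Good`). For such m, `core` sends every nonface p contained
in the support of m to the face (p ∖ b) ∪ a of N, and to a face of Ñ if p does not contain b. Two
principles govern the scalars. They do not change under multiplication by a monomial as long as the
source degree contains b (`shiftCoeff_monomial_smul`). They vanish if the element is a monomial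
multiple of one whose degree misses a point of b, because the smaller degree would be shifted to a
negative exponent (`shiftCoeff_monomial_smul_eq_zero`).

For Hom(I_X, A_X) these principles say that the scalar at x^m depends only on the core of m, that it
agrees on f and g whenever f ∪ g is a face, and that it vanishes on Ñ. This is a 0-cocycle of the
kernel complex, and there are no coboundaries in degree 0 (`homMap_injective`, `homMap_surjective`).

For T² the relations are spanned over ℂ by the Taylor relations x^{m-p} e_p - x^{m-q} e_q
(`span_taylor`). A 1-cocycle λ sends such a relation to λ(core p, core q) x^{m+a-b}; the cocycle
identity makes this well defined, and vanishing on Ñ makes it linear and kills the Koszul relations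
(`relLin_koszul`). Homomorphisms on the free module contribute differences μ_p - μ_q, which yield
exactly the coboundaries (`coboundaries_le_ker`, `ker_le_coboundaries`). Conversely, a given ψ is
made to depend only on cores by choosing for each f in N one nonface with core f and subtracting a
restriction from the free module (`relMap_surjective`). The resulting cochain vanishes on Ñ by
`relCoeff_eq_zero`, the one place where vanishing on Koszul relations is needed.

A derivation acts through the operators ∂/∂x_i, each of which lowers only one exponent. Hence it
reaches degree a - b only if b has at most one element. For b = ∅ the set N is empty, and for b =
{i} everything is a multiple of x^a ∂/∂x_i. -/

/-- The characteristic vector of `s ⊆ [n]` as an exponent. -/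
def ind (s : Finset (Fin (n + 1))) : Fin (n + 1) →₀ ℕ :=
  Finsupp.equivFunOnFinite.symm fun i => if i ∈ s then 1 else 0

@[simp]
theorem ind_apply (s : Finset (Fin (n + 1))) (i : Fin (n + 1)) :
    ind s i = if i ∈ s then 1 else 0 := rfl

@[simp]
theorem support_ind (s : Finset (Fin (n + 1))) : (ind s).support = s := by
  ext i; simp

theorem ind_le_iff {s : Finset (Fin (n + 1))} {m : Fin (n + 1) →₀ ℕ} :
    ind s ≤ m ↔ s ⊆ m.support := by
  constructor
  · intro h i hi
    have := h i
    simp only [ind_apply, hi, if_true] at this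
    simp only [Finsupp.mem_support_iff]; omega
  · intro h i
    by_cases hi : i ∈ s
    · have := h hi
      simp only [Finsupp.mem_support_iff] at this
      simp only [ind_apply, hi, if_true]; omega
    · simp [hi]

theorem ind_mono {s t : Finset (Fin (n + 1))} (h : s ⊆ t) : ind s ≤ ind t :=
  ind_le_iff.2 (by simpa using h)

theorem support_mono' {m m' : Fin (n + 1) →₀ ℕ} (h : m ≤ m') : m.support ⊆ m'.support := by
  intro i hi
  have := h i
  simp only [Finsupp.mem_support_iff] at hi ⊢
  omega

variable (X : FaceComplex n)

theorem gen_eq (p : X.Nonface) : X.gen p = monomial (ind p.1) 1 := by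
  have h : ind p.1 = ∑ i ∈ p.1, Finsupp.single i 1 := by
    ext j
    simp [Finsupp.finsetSum_apply, Finsupp.single_apply]
  rw [h, monomial_sum_one]
  rfl

theorem mem_I_iff {x : P n} : x ∈ X.I ↔ ∀ m ∈ x.support, m.support ∉ X.faces := by
  have h : Set.range X.gen =
      (fun s => monomial s (1 : ℂ)) '' Set.range (fun p : X.Nonface => ind p.1) := by
    rw [← Set.range_comp]
    exact congrArg Set.range (funext fun p => X.gen_eq p)
  rw [I, h, mem_ideal_span_monomial_image]
  refine forall₂_congr fun m _ => ?_
  constructor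
  · rintro ⟨_, ⟨p, rfl⟩, hp⟩ hm
    exact p.2 (X.down_closed hm (ind_le_iff.1 hp))
  · exact fun hm => ⟨_, ⟨⟨_, hm⟩, rfl⟩, ind_le_iff.2 subset_rfl⟩

theorem monomial_mem_I {m : Fin (n + 1) →₀ ℕ} (h : m.support ∉ X.faces) (t : ℂ) :
    monomial m t ∈ X.I := by
  classical
  rw [mem_I_iff]
  intro u hu
  have := support_monomial_subset hu
  rw [Finset.mem_singleton] at this
  rwa [this]

open scoped Classical in
/-- The coefficient of `x^m` of an element of `A_X`, which is `0` if the support of `m` is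
no face. -/
def coeffA (m : Fin (n + 1) →₀ ℕ) : X.A →ₗ[ℂ] ℂ :=
  if h : m.support ∈ X.faces then
    (Submodule.liftQ (X.I.restrictScalars ℂ) (lcoeff ℂ m) (fun x hx => by
      by_contra h2
      exact (X.mem_I_iff.1 hx) m (mem_support_iff.2 h2) h)) ∘ₗ
      (Submodule.Quotient.restrictScalarsEquiv ℂ X.I).symm.toLinearMap
  else 0

theorem coeffA_mkQ {m : Fin (n + 1) →₀ ℕ} (h : m.support ∈ X.faces) (x : P n) :
    X.coeffA m (Submodule.mkQ X.I x) = coeff m x := by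
  rw [coeffA, dif_pos h]
  rfl

theorem mem_gradedP_iff {d : Fin (n + 1) → ℤ} {x : P n} :
    x ∈ gradedP d ↔ ∀ m ∈ x.support, ∀ i, (m i : ℤ) = d i := by
  have hw : ∀ m : Fin (n + 1) →₀ ℕ,
      Finsupp.weight (fun i => (Pi.single i 1 : Fin (n + 1) → ℤ)) m = fun i => (m i : ℤ) := by
    intro m
    funext i
    rw [Finsupp.weight_apply, Finsupp.sum_fintype _ _ (by simp)]
    simp [Finset.sum_apply, Pi.single_apply]
  rw [gradedP, mem_weightedHomogeneousSubmodule, IsWeightedHomogeneous]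
  simp only [mem_support_iff, hw]
  exact ⟨fun h m hm i => congrFun (h hm) i, fun h m hm => funext (h m hm)⟩

theorem monomial_mem_gradedP {d : Fin (n + 1) → ℤ} {m : Fin (n + 1) →₀ ℕ} (t : ℂ)
    (h : ∀ i, (m i : ℤ) = d i) : monomial m t ∈ gradedP d := by
  classical
  rw [mem_gradedP_iff]
  intro u hu
  have := support_monomial_subset hu
  rw [Finset.mem_singleton] at this
  rwa [this]

/-! ### Shifted monomials -/

variable (a : Fin (n + 1) →₀ ℕ) (b : Finset (Fin (n + 1)))

/-- The degree `a - b` as an integer vector. -/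
def shift : Fin (n + 1) → ℤ := fun i => (a i : ℤ) - char b i

/-- The exponents `m` for which `x^{m + a - b}` exists and is nonzero in `A_X`. -/
def Good (m : Fin (n + 1) →₀ ℕ) : Prop :=
  b ⊆ m.support ∧ (m + a - ind b).support ∈ X.faces

open scoped Classical in
/-- The class of `x^{m + a - b}` in `A_X`, with value `0` if there is a negative exponent. -/
def shiftMon (m : Fin (n + 1) →₀ ℕ) : X.A :=
  if X.Good a b m then Submodule.mkQ X.I (monomial (m + a - ind b) 1) else 0

open scoped Classical in
/-- The coefficient of `x^{m + a - b}`. -/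
def shiftCoeff (m : Fin (n + 1) →₀ ℕ) : X.A →ₗ[ℂ] ℂ :=
  if X.Good a b m then X.coeffA (m + a - ind b) else 0

variable {X a b}

theorem shiftCoeff_shiftMon {m : Fin (n + 1) →₀ ℕ} (h : X.Good a b m) :
    X.shiftCoeff a b m (X.shiftMon a b m) = 1 := by
  rw [shiftCoeff, shiftMon, if_pos h, if_pos h, coeffA_mkQ _ h.2, coeff_monomial, if_pos rfl]

theorem shiftMon_ne_zero {m : Fin (n + 1) →₀ ℕ} (h : X.Good a b m) :
    X.shiftMon a b m ≠ 0 := by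
  intro h0
  have := shiftCoeff_shiftMon h
  rw [h0, map_zero] at this
  exact zero_ne_one this

theorem shiftMon_of_not_good {m : Fin (n + 1) →₀ ℕ} (h : ¬ X.Good a b m) :
    X.shiftMon a b m = 0 := if_neg h

theorem Good.mono {m m' : Fin (n + 1) →₀ ℕ} (h : X.Good a b m') (hle : m ≤ m')
    (hb : b ⊆ m.support) : X.Good a b m :=
  ⟨hb, X.down_closed h.2 (support_mono' fun i => by
    have := hle i
    simp only [Finsupp.coe_tsub, Finsupp.coe_add, Pi.sub_apply, Pi.add_apply]; omega)⟩

/-- The fine grading leaves only one candidate monomial in degree m + a - b. Disjointness of a and b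
gives a_i = 0 on b, so a nonnegative exponent there forces b into the support of m, and the
truncated subtraction is the true one. -/
theorem eq_shiftCoeff_smul {m : Fin (n + 1) →₀ ℕ} (hab : Disjoint a.support b) {y : X.A}
    {d : Fin (n + 1) → ℤ} (hd : ∀ i, d i = m i)
    (hy : y ∈ X.gradedA (d + shift a b)) :
    y = X.shiftCoeff a b m y • X.shiftMon a b m := by
  obtain ⟨x, hx, rfl⟩ := hy
  rw [LinearMap.restrictScalars_apply]
  have hx' := mem_gradedP_iff.1 hx
  have key : ∀ u ∈ x.support, b ⊆ m.support ∧ u = m + a - ind b := by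
    intro u hu
    have h := hx' u hu
    constructor
    · intro i hi
      have h1 := h i
      have h2 : a i = 0 := by
        by_contra h2
        exact Finset.disjoint_left.1 hab (Finsupp.mem_support_iff.2 h2) hi
      simp only [Pi.add_apply, shift, char, hi, if_true, hd, h2] at h1
      simp only [Finsupp.mem_support_iff]
      omega
    · ext i
      have h1 := h i
      simp only [Pi.add_apply, shift, char, hd] at h1
      simp only [Finsupp.coe_tsub, Finsupp.coe_add, Pi.sub_apply, Pi.add_apply, ind_apply]
      split_ifs at h1 ⊢ <;> omega
  by_cases h : X.Good a b m
  · have hx2 : x = monomial (m + a - ind b) (coeff (m + a - ind b) x) := by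
      ext u
      rw [coeff_monomial]
      split_ifs with hu
      · rw [hu]
      · by_contra hne
        exact hu (key u (mem_support_iff.2 hne)).2.symm
    rw [shiftCoeff, shiftMon, if_pos h, if_pos h, coeffA_mkQ _ h.2]
    conv_lhs => rw [hx2]
    rw [← mul_one (coeff _ x), ← smul_eq_mul, ← smul_monomial, smul_eq_mul, mul_one]
    exact LinearMap.map_smul_of_tower _ _ _
  · rw [shiftMon_of_not_good h, smul_zero, Submodule.mkQ_apply, Submodule.Quotient.mk_eq_zero,
      mem_I_iff]
    intro u hu hf
    obtain ⟨h1, rfl⟩ := key u hu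
    exact h ⟨h1, hf⟩

theorem shiftMon_mem {m : Fin (n + 1) →₀ ℕ}
    {d : Fin (n + 1) → ℤ} (hd : ∀ i, d i = m i) :
    X.shiftMon a b m ∈ X.gradedA (d + shift a b) := by
  rw [shiftMon]
  split_ifs with h
  · refine ⟨_, monomial_mem_gradedP 1 fun i => ?_, rfl⟩
    have h1 := @h.1 i
    simp only [Pi.add_apply, shift, char, hd, Finsupp.coe_tsub, Finsupp.coe_add, Pi.sub_apply,
      ind_apply]
    simp only [Finsupp.mem_support_iff] at h1
    split_ifs with hi
    · have := h1 hi; omega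
    · omega
  · exact zero_mem _

/-- Containment of b in the support of m cannot be dropped: otherwise the left side is 0, while
x^{u+m+a-b} may well be nonzero. Compensating for this failure is the role of the vanishing
conditions on Ñ. -/
theorem monomial_smul_shiftMon {m : Fin (n + 1) →₀ ℕ} (hb : b ⊆ m.support)
    (u : Fin (n + 1) →₀ ℕ) :
    (monomial u (1 : ℂ) : P n) • X.shiftMon a b m = X.shiftMon a b (u + m) := by
  have hle : m ≤ u + m := le_add_self
  have hE : u + (m + a - ind b) = u + m + a - ind b := by
    rw [add_assoc u, add_tsub_assoc_of_le ((ind_le_iff.2 hb).trans le_self_add)]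
  by_cases h : X.Good a b (u + m)
  · rw [shiftMon, shiftMon, if_pos h, if_pos (h.mono hle hb), ← map_smul, smul_eq_mul,
      monomial_mul, hE, one_mul]
  · rw [shiftMon_of_not_good h]
    by_cases h' : X.Good a b m
    · rw [shiftMon, if_pos h', ← map_smul, smul_eq_mul,
        monomial_mul, hE, one_mul, Submodule.mkQ_apply, Submodule.Quotient.mk_eq_zero]
      exact X.monomial_mem_I (fun hf => h ⟨hb.trans (support_mono' hle), hf⟩) _
    · rw [shiftMon_of_not_good h', smul_zero]

theorem shiftCoeff_monomial_smul {m u : Fin (n + 1) →₀ ℕ} (hb : b ⊆ m.support)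
    (h : X.Good a b (u + m)) (y : X.A) :
    X.shiftCoeff a b (u + m) ((monomial u (1 : ℂ) : P n) • y) = X.shiftCoeff a b m y := by
  have hle : m ≤ u + m := le_add_self
  have hE : u + m + a - ind b = u + (m + a - ind b) := by
    rw [add_assoc u, add_tsub_assoc_of_le ((ind_le_iff.2 hb).trans le_self_add)]
  obtain ⟨x, rfl⟩ := Submodule.mkQ_surjective _ y
  rw [shiftCoeff, shiftCoeff, if_pos h, if_pos (h.mono hle hb), ← map_smul, smul_eq_mul,
    coeffA_mkQ _ h.2, coeffA_mkQ _ (h.mono hle hb).2, hE, coeff_monomial_mul, one_mul]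

/-- At a point i of b outside the support of m the target exponent is u_i - 1, since a_i = 0. So x^u
does not divide the target monomial, and no homogeneity of y is needed. -/
theorem shiftCoeff_monomial_smul_eq_zero {m u : Fin (n + 1) →₀ ℕ} (hab : Disjoint a.support b)
    (hb : ¬ b ⊆ m.support) (h : X.Good a b (u + m)) (y : X.A) :
    X.shiftCoeff a b (u + m) ((monomial u (1 : ℂ) : P n) • y) = 0 := by
  obtain ⟨x, rfl⟩ := Submodule.mkQ_surjective _ y
  rw [shiftCoeff, if_pos h, ← map_smul, smul_eq_mul, coeffA_mkQ _ h.2, coeff_monomial_mul',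
    if_neg]
  intro hle
  obtain ⟨i, hi, him⟩ := Finset.not_subset.1 hb
  have h2 : a i = 0 := by
    by_contra h2
    exact Finset.disjoint_left.1 hab (Finsupp.mem_support_iff.2 h2) hi
  have h3 := hle i
  have h4 := h.1 hi
  simp only [Finsupp.mem_support_iff, not_not, Finsupp.coe_add, Pi.add_apply] at him h4
  simp only [Finsupp.coe_tsub, Finsupp.coe_add, Pi.sub_apply, Pi.add_apply, ind_apply, hi,
    if_true] at h3
  omega

end

section

variable {n : ℕ} {X : FaceComplex n}

/-! ### Cochains of degrees `0` and `1` as total functions -/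

namespace USubset

/-- Extension by zero. It suffices to test whether all entries lie in Z, a condition invariant under
permutations: the union is a face, hence lies in Z by the U property. -/
theorem restr_surjective {Y Z : X.USubset} (h : Z.carrier ⊆ Y.carrier) (k : ℕ) :
    Function.Surjective (restr h k) := by
  classical
  rintro ⟨l, hl⟩
  have hperm : ∀ (f : Y.Tuple k) (σ : Equiv.Perm (Fin (k + 1))),
      (∀ i, (f.perm σ).1 i ∈ Z.carrier) ↔ ∀ i, f.1 i ∈ Z.carrier := fun f σ =>
    ⟨fun hf i => by simpa [Tuple.perm] using hf (σ.symm i), fun hf i => hf (σ i)⟩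
  let toZ : (f : Y.Tuple k) → (∀ i, f.1 i ∈ Z.carrier) → Z.Tuple k := fun f hf =>
    ⟨f.1, hf, Z.sup_mem _ hf (Y.subset f.2.2)⟩
  refine ⟨⟨fun f => if hf : ∀ i, f.1 i ∈ Z.carrier then l (toZ f hf) else 0, ?_⟩, ?_⟩
  · intro f σ
    beta_reduce
    by_cases hf : ∀ i, f.1 i ∈ Z.carrier
    · rw [dif_pos hf, dif_pos ((hperm f σ).2 hf)]
      exact hl (toZ f hf) σ
    · rw [dif_neg hf, dif_neg (mt (hperm f σ).1 hf), mul_zero]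
  · refine Subtype.ext (funext fun f => ?_)
    exact dif_pos f.2.1

variable {Y Z : X.USubset}

/-- A `0`-tuple. -/
def tuple0 (f : Finset (Fin (n + 1))) (hf : f ∈ Y.carrier) : Y.Tuple 0 :=
  ⟨fun _ => f, fun _ => hf, by simpa using hf⟩

/-- A `1`-tuple. -/
def tuple1 (f g : Finset (Fin (n + 1)))
    (h : f ∈ Y.carrier ∧ g ∈ Y.carrier ∧ f ∪ g ∈ X.faces) : Y.Tuple 1 :=
  have hm : ∀ i, (![f, g] : Fin 2 → _) i ∈ Y.carrier := by
    intro i; fin_cases i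
    · exact h.1
    · exact h.2.1
  ⟨![f, g], hm, Y.sup_mem _ hm (by simpa [Fin.univ_succ] using h.2.2)⟩

/-- A `2`-tuple. -/
def tuple2 (f g k : Finset (Fin (n + 1))) (hf : f ∈ Y.carrier) (hg : g ∈ Y.carrier)
    (hk : k ∈ Y.carrier) (h : f ∪ (g ∪ k) ∈ X.faces) : Y.Tuple 2 :=
  have hm : ∀ i, (![f, g, k] : Fin 3 → _) i ∈ Y.carrier := by
    intro i; fin_cases i
    · exact hf
    · exact hg
    · exact hk
  ⟨![f, g, k], hm, Y.sup_mem _ hm (by simpa [Fin.univ_succ] using h)⟩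

open scoped Classical in
/-- Evaluation of `0`-cochains, extended by zero. -/
def ev0 (Y : X.USubset) (f : Finset (Fin (n + 1))) : (Y.Tuple 0 → ℂ) →ₗ[ℂ] ℂ :=
  if h : f ∈ Y.carrier then LinearMap.proj (tuple0 f h) else 0

open scoped Classical in
/-- Evaluation of `1`-cochains, extended by zero. -/
def ev1 (Y : X.USubset) (f g : Finset (Fin (n + 1))) : (Y.Tuple 1 → ℂ) →ₗ[ℂ] ℂ :=
  if h : f ∈ Y.carrier ∧ g ∈ Y.carrier ∧ f ∪ g ∈ X.faces then LinearMap.proj (tuple1 f g h)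
  else 0

theorem ev0_eq {f : Finset (Fin (n + 1))} (h : f ∈ Y.carrier) (l : Y.Tuple 0 → ℂ) :
    ev0 Y f l = l (tuple0 f h) := by
  rw [ev0, dif_pos h]; rfl

theorem ev1_eq {f g : Finset (Fin (n + 1))}
    (h : f ∈ Y.carrier ∧ g ∈ Y.carrier ∧ f ∪ g ∈ X.faces) (l : Y.Tuple 1 → ℂ) :
    ev1 Y f g l = l (tuple1 f g h) := by
  rw [ev1, dif_pos h]; rfl

theorem tuple0_eq (t : Y.Tuple 0) : tuple0 (t.1 0) (t.2.1 0) = t :=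
  Subtype.ext (funext fun i => by fin_cases i; rfl)

theorem tuple1_union_mem (t : Y.Tuple 1) :
    t.1 0 ∈ Y.carrier ∧ t.1 1 ∈ Y.carrier ∧ t.1 0 ∪ t.1 1 ∈ X.faces :=
  ⟨t.2.1 0, t.2.1 1, by simpa [Fin.univ_succ] using Y.subset t.2.2⟩

theorem tuple1_eq (t : Y.Tuple 1) : tuple1 (t.1 0) (t.1 1) (tuple1_union_mem t) = t :=
  Subtype.ext (funext fun i => by fin_cases i <;> rfl)

theorem tuple2_union_mem (t : Y.Tuple 2) : t.1 0 ∪ (t.1 1 ∪ t.1 2) ∈ X.faces := by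
  simpa [Fin.univ_succ] using Y.subset t.2.2

theorem ext_ev0 {l l' : Y.Tuple 0 → ℂ} (h : ∀ f ∈ Y.carrier, ev0 Y f l = ev0 Y f l') :
    l = l' := by
  funext t
  have := h _ (t.2.1 0)
  rwa [ev0_eq (t.2.1 0), ev0_eq (t.2.1 0), tuple0_eq] at this

theorem ext_ev1 {l l' : Y.Tuple 1 → ℂ} (h : ∀ f g, f ∈ Y.carrier → g ∈ Y.carrier →
    f ∪ g ∈ X.faces → ev1 Y f g l = ev1 Y f g l') : l = l' := by
  funext t
  have h1 := tuple1_union_mem t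
  have := h _ _ h1.1 h1.2.1 h1.2.2
  rwa [ev1_eq h1, ev1_eq h1, tuple1_eq] at this

theorem dFun_tuple1 (l : Y.Tuple 0 → ℂ) {f g : Finset (Fin (n + 1))}
    (h : f ∈ Y.carrier ∧ g ∈ Y.carrier ∧ f ∪ g ∈ X.faces) :
    Y.dFun 0 l (tuple1 f g h) = ev0 Y g l - ev0 Y f l := by
  have h0 : (tuple1 f g h).face 0 = tuple0 g h.2.1 :=
    Subtype.ext (funext fun i => by fin_cases i; rfl)
  have h1 : (tuple1 f g h).face 1 = tuple0 f h.1 :=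
    Subtype.ext (funext fun i => by fin_cases i; rfl)
  rw [ev0_eq h.1, ev0_eq h.2.1]
  change ∑ v : Fin 2, (-1) ^ (v : ℕ) * l ((tuple1 f g h).face v) = _
  rw [Fin.sum_univ_two, h0, h1]
  simp [sub_eq_add_neg]

theorem dFun_tuple2 (l : Y.Tuple 1 → ℂ) {f g k : Finset (Fin (n + 1))} (hf : f ∈ Y.carrier)
    (hg : g ∈ Y.carrier) (hk : k ∈ Y.carrier) (h : f ∪ (g ∪ k) ∈ X.faces) :
    Y.dFun 1 l (tuple2 f g k hf hg hk h) = ev1 Y g k l - ev1 Y f k l + ev1 Y f g l := by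
  have hgk : g ∪ k ∈ X.faces := X.down_closed h (by grind)
  have hfk : f ∪ k ∈ X.faces := X.down_closed h (by grind)
  have hfg : f ∪ g ∈ X.faces := X.down_closed h (by grind)
  have h0 : (tuple2 f g k hf hg hk h).face 0 = tuple1 g k ⟨hg, hk, hgk⟩ :=
    Subtype.ext (funext fun i => by fin_cases i <;> rfl)
  have h1 : (tuple2 f g k hf hg hk h).face 1 = tuple1 f k ⟨hf, hk, hfk⟩ :=
    Subtype.ext (funext fun i => by fin_cases i <;> rfl)
  have h2 : (tuple2 f g k hf hg hk h).face 2 = tuple1 f g ⟨hf, hg, hfg⟩ :=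
    Subtype.ext (funext fun i => by fin_cases i <;> rfl)
  rw [ev1_eq ⟨hg, hk, hgk⟩, ev1_eq ⟨hf, hk, hfk⟩, ev1_eq ⟨hf, hg, hfg⟩]
  change ∑ v : Fin 3, (-1) ^ (v : ℕ) * l ((tuple2 f g k hf hg hk h).face v) = _
  rw [Fin.sum_univ_three, h0, h1, h2]
  simp [sub_eq_add_neg]

variable {h : Z.carrier ⊆ Y.carrier}

theorem ev0_eq_zero {l : Y.Tuple 0 → ℂ} (hl : l ∈ kerK h 0) {f : Finset (Fin (n + 1))}
    (hf : f ∈ Z.carrier) : ev0 Y f l = 0 := by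
  rw [ev0_eq (h hf)]
  exact congrFun hl.2 (tuple0 f hf)

theorem ev1_eq_zero {l : Y.Tuple 1 → ℂ} (hl : l ∈ kerK h 1) {f g : Finset (Fin (n + 1))}
    (hf : f ∈ Z.carrier) (hg : g ∈ Z.carrier) : ev1 Y f g l = 0 := by
  by_cases hfg : f ∪ g ∈ X.faces
  · rw [ev1_eq ⟨h hf, h hg, hfg⟩]
    exact congrFun hl.2 (tuple1 f g ⟨hf, hg, hfg⟩)
  · rw [ev1, dif_neg fun hh => hfg hh.2.2]; rfl

theorem ev0_congr {l : Y.Tuple 0 → ℂ} (hl : l ∈ cocycles h 0) {f g : Finset (Fin (n + 1))}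
    (hf : f ∈ Y.carrier) (hg : g ∈ Y.carrier) (hfg : f ∪ g ∈ X.faces) :
    ev0 Y f l = ev0 Y g l := by
  have := congrFun hl.2 (tuple1 f g ⟨hf, hg, hfg⟩)
  rw [dFun_tuple1] at this
  exact (sub_eq_zero.1 this).symm

theorem ev1_add {l : Y.Tuple 1 → ℂ} (hl : l ∈ cocycles h 1) {f g k : Finset (Fin (n + 1))}
    (hf : f ∈ Y.carrier) (hg : g ∈ Y.carrier) (hk : k ∈ Y.carrier)
    (hfgk : f ∪ (g ∪ k) ∈ X.faces) : ev1 Y f g l + ev1 Y g k l = ev1 Y f k l := by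
  have := congrFun hl.2 (tuple2 f g k hf hg hk hfgk)
  rw [dFun_tuple2, Pi.zero_apply] at this
  linear_combination this

theorem mem_kerK_zero {L : Finset (Fin (n + 1)) → ℂ} (hL : ∀ f ∈ Z.carrier, L f = 0) :
    (fun t : Y.Tuple 0 => L (t.1 0)) ∈ kerK h 0 := by
  refine ⟨fun f σ => ?_, funext fun t => hL _ (t.2.1 0)⟩
  obtain rfl : σ = 1 := Subsingleton.elim (α := Equiv.Perm (Fin 1)) σ 1
  change L (f.1 0) = _
  simp

theorem ev0_mk (L : Finset (Fin (n + 1)) → ℂ) {f : Finset (Fin (n + 1))} (hf : f ∈ Y.carrier) :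
    ev0 Y f (fun t : Y.Tuple 0 => L (t.1 0)) = L f := by
  rw [ev0_eq hf]; rfl

theorem ev1_mk (L : Finset (Fin (n + 1)) → Finset (Fin (n + 1)) → ℂ)
    {f g : Finset (Fin (n + 1))} (hf : f ∈ Y.carrier) (hg : g ∈ Y.carrier)
    (hfg : f ∪ g ∈ X.faces) : ev1 Y f g (fun t : Y.Tuple 1 => L (t.1 0) (t.1 1)) = L f g := by
  rw [ev1_eq ⟨hf, hg, hfg⟩]; rfl

theorem mem_cocycles_zero {L : Finset (Fin (n + 1)) → ℂ} (hL : ∀ f ∈ Z.carrier, L f = 0)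
    (hd : ∀ f g, f ∈ Y.carrier → g ∈ Y.carrier → f ∪ g ∈ X.faces → L f = L g) :
    (fun t : Y.Tuple 0 => L (t.1 0)) ∈ cocycles h 0 := by
  refine ⟨mem_kerK_zero hL, funext fun t => ?_⟩
  obtain ⟨h1, h2, h3⟩ := tuple1_union_mem t
  rw [← tuple1_eq t, dFun_tuple1, ev0_mk _ h1, ev0_mk _ h2, hd _ _ h1 h2 h3, sub_self]
  rfl

/-- Alternation need not be assumed: additivity at (f, f, f) gives L f f = 0, and at (f, g, f) it
gives antisymmetry. -/
theorem mem_cocycles_one {L : Finset (Fin (n + 1)) → Finset (Fin (n + 1)) → ℂ}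
    (hL : ∀ f g, f ∈ Z.carrier → g ∈ Z.carrier → f ∪ g ∈ X.faces → L f g = 0)
    (hd : ∀ f g k, f ∈ Y.carrier → g ∈ Y.carrier → k ∈ Y.carrier → f ∪ (g ∪ k) ∈ X.faces →
      L f g + L g k = L f k) :
    (fun t : Y.Tuple 1 => L (t.1 0) (t.1 1)) ∈ cocycles h 1 := by
  have hself : ∀ f ∈ Y.carrier, L f f = 0 := fun f hf => by
    have := hd f f f hf hf hf (by simpa using Y.subset hf)
    linear_combination this
  refine ⟨⟨mem_K_of_swap fun i t => ?_, funext fun t => ?_⟩, funext fun t => ?_⟩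
  · fin_cases i
    obtain ⟨h1, h2, h3⟩ := tuple1_union_mem t
    have := hd _ _ _ h1 h2 h1 (by rwa [Finset.union_comm (t.1 1), ← Finset.union_assoc,
      Finset.union_self])
    rw [hself _ h1] at this
    change L (t.1 1) (t.1 0) = - L (t.1 0) (t.1 1)
    linear_combination this
  · obtain ⟨h1, h2, h3⟩ := tuple1_union_mem t
    exact hL _ _ h1 h2 h3
  · have h1 := t.2.1 0
    have h2 := t.2.1 1
    have h3 := t.2.1 2
    have h4 := tuple2_union_mem t
    have ht : tuple2 _ _ _ h1 h2 h3 h4 = t :=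
      Subtype.ext (funext fun i => by fin_cases i <;> rfl)
    rw [← ht, dFun_tuple2, ev1_mk _ h1 h2 (X.down_closed h4 (by grind)),
      ev1_mk _ h2 h3 (X.down_closed h4 (by grind)), ev1_mk _ h1 h3 (X.down_closed h4 (by grind)),
      ← hd _ _ _ h1 h2 h3 h4, Pi.zero_apply]
    ring

end USubset

/-! ### From exponents to faces -/

/-- The set `(s ∖ b) ∪ a`. -/
def core (a : Fin (n + 1) →₀ ℕ) (b s : Finset (Fin (n + 1))) : Finset (Fin (n + 1)) :=
  s \ b ∪ a.support

variable {a : Fin (n + 1) →₀ ℕ} {b : Finset (Fin (n + 1))}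

theorem core_mono {s t : Finset (Fin (n + 1))} (h : s ⊆ t) : core a b s ⊆ core a b t :=
  Finset.union_subset_union_left (Finset.sdiff_subset_sdiff h subset_rfl)

theorem core_mem_N (hab : Disjoint a.support b) {s : Finset (Fin (n + 1))} (hs : s ∉ X.faces)
    (h : core a b s ∈ X.faces) : core a b s ∈ (X.N a.support b).carrier := by
  have := Finset.disjoint_left.1 hab
  refine ⟨h, Finset.subset_union_right, ?_, fun h1 => hs (X.down_closed h1 ?_)⟩
  · unfold core; grind
  · unfold core; grind

/-- The proper subset of b required by Ñ is s ∩ b, since core s together with s ∩ b contains the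
nonface s. -/
theorem core_mem_NTilde (hab : Disjoint a.support b) {s : Finset (Fin (n + 1))}
    (hs : s ∉ X.faces) (h : core a b s ∈ X.faces) (hb : ¬ b ⊆ s) :
    core a b s ∈ (X.NTilde a.support b).carrier := by
  refine ⟨core_mem_N hab hs h, s ∩ b, ?_, fun h1 => hs (X.down_closed h1 ?_)⟩
  · refine ⟨Finset.inter_subset_right, fun h1 => hb (h1.trans Finset.inter_subset_left)⟩
  · unfold core; grind

/-- Outside b the exponents of x^{m+a-b} are m_i + a_i, so its support contains the core. -/
theorem Good.core_mem (hab : Disjoint a.support b) {m : Fin (n + 1) →₀ ℕ}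
    (hm : X.Good a b m) : core a b m.support ∈ X.faces := by
  refine X.down_closed hm.2 fun i hi => ?_
  have := fun h : i ∈ a.support => Finset.disjoint_left.1 hab h
  simp only [core, Finset.mem_union, Finset.mem_sdiff, Finsupp.mem_support_iff] at hi this
  simp only [Finsupp.mem_support_iff, Finsupp.coe_tsub, Finsupp.coe_add, Pi.sub_apply,
    Pi.add_apply, ind_apply]
  split_ifs with hib
  · rcases hi with hi | hi
    · exact absurd hib hi.2
    · exact absurd hib (this hi)
  · omega

theorem core_subset {p s : Finset (Fin (n + 1))} (h : p ⊆ s) (ha : a.support ⊆ s) :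
    core a b p ⊆ s := by
  unfold core; grind

/-- `x^{s + b + a - b}` is a nonzero monomial of `A_X` for a face `s ⊇ a`. -/
theorem good_ind {s : Finset (Fin (n + 1))} (hs : s ∈ X.faces) (ha : a.support ⊆ s) :
    X.Good a b (ind (s ∪ b)) := by
  refine ⟨by simp, X.down_closed hs fun i hi => ?_⟩
  have := @ha i
  simp only [Finsupp.mem_support_iff, Finsupp.coe_tsub, Finsupp.coe_add, Pi.sub_apply,
    Pi.add_apply, ind_apply, Finset.mem_union] at hi this
  by_contra his
  simp only [his, false_or] at hi this
  have h0 : a i = 0 := by simpa using this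
  rw [h0] at hi
  exact hi (by simp)

/-- A section of `core` over N. In general f ∪ b serves; over Ñ the definition supplies a nonface f
∪ b' that misses a point of b, and this choice makes the later cochains vanish on Ñ. -/
theorem exists_nonface {f : Finset (Fin (n + 1))} (hf : f ∈ (X.N a.support b).carrier) :
    ∃ p : X.Nonface, p.1 ⊆ f ∪ b ∧ core a b p.1 = f ∧
      (f ∈ (X.NTilde a.support b).carrier → ¬ b ⊆ p.1) := by
  obtain ⟨hf1, hf2, hf3, hf4⟩ := hf
  have hd := Finset.disjoint_left.1 (Finset.disjoint_iff_inter_eq_empty.2 hf3)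
  by_cases h : f ∈ (X.NTilde a.support b).carrier
  · obtain ⟨-, b', hb', hb2⟩ := h
    refine ⟨⟨f ∪ b', hb2⟩, Finset.union_subset_union_right hb'.1, ?_, fun _ h2 => hb'.2 ?_⟩
    · have := hb'.1
      unfold core; grind
    · intro i hi
      have := h2 hi
      simp only [Finset.mem_union] at this
      exact this.resolve_left fun h3 => hd h3 hi
  · refine ⟨⟨f ∪ b, hf4⟩, subset_rfl, ?_, fun h2 => absurd h2 h⟩
    unfold core; grind

end

section

variable {n : ℕ} {X : FaceComplex n}

/-! ### Linear maps given on monomials -/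

/-- The `ℂ`-linear map with prescribed values on monomials. -/
def monoMap {M : Type*} [AddCommGroup M] [Module ℂ M] (f : (Fin (n + 1) →₀ ℕ) → M) :
    P n →ₗ[ℂ] M := (basisMonomials (Fin (n + 1)) ℂ).constr ℂ f

section monoMap

variable {M : Type*} [AddCommGroup M] [Module ℂ M]

theorem monoMap_monomial_one (f : (Fin (n + 1) →₀ ℕ) → M) (m : Fin (n + 1) →₀ ℕ) :
    monoMap f (monomial m 1) = f m := by
  have := (basisMonomials (Fin (n + 1)) ℂ).constr_basis ℂ f m
  rwa [coe_basisMonomials] at this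

theorem monoMap_monomial (f : (Fin (n + 1) →₀ ℕ) → M) (m : Fin (n + 1) →₀ ℕ) (t : ℂ) :
    monoMap f (monomial m t) = t • f m := by
  rw [← monoMap_monomial_one f m, ← map_smul, smul_monomial, smul_eq_mul, mul_one]

theorem monoMap_mem (f : (Fin (n + 1) →₀ ℕ) → M) (S : Submodule ℂ M) {x : P n}
    (h : ∀ m ∈ x.support, f m ∈ S) : monoMap f x ∈ S := by
  rw [x.as_sum, map_sum]
  exact S.sum_mem fun m hm => by
    rw [monoMap_monomial]
    exact S.smul_mem _ (h m hm)

end monoMap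

theorem monomial_add_single (m : Fin (n + 1) →₀ ℕ) (i : Fin (n + 1)) :
    (MvPolynomial.X i : P n) * monomial m 1 = monomial (Finsupp.single i 1 + m) 1 := by
  rw [MvPolynomial.X, monomial_mul, one_mul]

/-- A `ℂ`-linear map between `P`-modules which commutes with the variables is `P`-linear. -/
theorem map_smul_of_forall_X {M N : Type*} [AddCommGroup M] [AddCommGroup N] [Module ℂ M]
    [Module ℂ N] [Module (P n) M] [Module (P n) N] [IsScalarTower ℂ (P n) M]
    [IsScalarTower ℂ (P n) N] (f : M →ₗ[ℂ] N)
    (h : ∀ (i : Fin (n + 1)) (x : M),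
      f ((MvPolynomial.X i : P n) • x) = (MvPolynomial.X i : P n) • f x) (s : P n) (x : M) :
    f (s • x) = s • f x := by
  induction s using MvPolynomial.induction_on generalizing x with
  | C t =>
    rw [← MvPolynomial.algebraMap_eq, algebraMap_smul, algebraMap_smul, map_smul]
  | add p q hp hq => rw [add_smul, add_smul, map_add, hp, hq]
  | mul_X p i hp => rw [mul_smul, mul_smul, hp, h]

/-- A monomial of `I_X`. -/
def monI (m : Fin (n + 1) →₀ ℕ) (hm : m.support ∉ X.faces) : X.I :=
  ⟨monomial m 1, X.monomial_mem_I hm 1⟩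

theorem sum_monomial_mem_I (x : X.I) (S : Submodule ℂ (P n))
    (hS : ∀ m, m ∈ (x : P n).support → m.support ∉ X.faces → monomial m 1 ∈ S) :
    (x : P n) ∈ S := by
  rw [(x : P n).as_sum]
  refine S.sum_mem fun m hm => ?_
  rw [← mul_one (coeff m (x : P n)), ← smul_eq_mul, ← smul_monomial]
  exact S.smul_mem _ (hS m hm (X.mem_I_iff.1 x.2 m hm))

theorem span_monI : Submodule.span ℂ
    {x : X.I | ∃ m hm, x = monI m hm} = ⊤ := by
  rw [eq_top_iff]
  rintro x -
  have := sum_monomial_mem_I x ((Submodule.span ℂ {x : X.I | ∃ m hm, x = monI m hm}).map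
    (X.I.subtype.restrictScalars ℂ)) fun m _ hm =>
      ⟨monI m hm, Submodule.subset_span ⟨m, hm, rfl⟩, rfl⟩
  obtain ⟨y, hy, hxy⟩ := this
  rwa [← Subtype.ext hxy]

theorem X_smul_monI (i : Fin (n + 1)) (m : Fin (n + 1) →₀ ℕ) (hm : m.support ∉ X.faces)
    (hm' : (Finsupp.single i 1 + m).support ∉ X.faces) :
    (MvPolynomial.X i : P n) • (monI m hm : X.I) = monI (Finsupp.single i 1 + m) hm' :=
  Subtype.ext (monomial_add_single m i)

theorem homI_ext {φ φ' : X.I →ₗ[P n] X.A} (h : ∀ m hm, φ (monI m hm) = φ' (monI m hm)) :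
    φ = φ' := by
  have : φ.restrictScalars ℂ = φ'.restrictScalars ℂ := by
    refine LinearMap.ext_on span_monI ?_
    rintro _ ⟨m, hm, rfl⟩
    exact h m hm
  exact LinearMap.ext fun x => LinearMap.congr_fun this x

/-! ### The degree `a - b` part of `Hom(I_X, A_X)` -/

variable {a : Fin (n + 1) →₀ ℕ} {b : Finset (Fin (n + 1))}

variable (X a b) in
/-- Cocycles of degree `k` for the pair `Ñ_{a-b} ⊆ N_{a-b}`. -/
abbrev Z (k : ℕ) : Submodule ℂ ((X.N a.support b).Tuple k → ℂ) :=
  cocycles (X.NTilde_subset_N a.support b) k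

/-- Multiplication of a shifted monomial with a variable. -/
theorem X_smul_shiftMon {m : Fin (n + 1) →₀ ℕ} (hb : b ⊆ m.support) (i : Fin (n + 1)) :
    (MvPolynomial.X i : P n) • X.shiftMon a b m = X.shiftMon a b (Finsupp.single i 1 + m) :=
  monomial_smul_shiftMon hb _

/-- The map `x^m ↦ λ(core m) x^{m + a - b}`. -/
def homPre (l : (X.N a.support b).Tuple 0 → ℂ) : P n →ₗ[ℂ] X.A :=
  monoMap fun m => ev0 _ (core a b m.support) l • X.shiftMon a b m

theorem homPre_monI (l : (X.N a.support b).Tuple 0 → ℂ) (m : Fin (n + 1) →₀ ℕ)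
    (hm : m.support ∉ X.faces) : homPre l (monI m hm : X.I) =
      ev0 _ (core a b m.support) l • X.shiftMon a b m :=
  monoMap_monomial_one _ _

/-- If x_i x^m has a nonzero shift, the cores of the two exponents are nested faces of N, so the
cocycle takes the same value on both. -/
theorem homPre_X_smul (hab : Disjoint a.support b) {l : (X.N a.support b).Tuple 0 → ℂ}
    (hl : l ∈ X.Z a b 0) (i : Fin (n + 1)) (x : X.I) :
    homPre l (((MvPolynomial.X i : P n) • x : X.I) : P n)
      = (MvPolynomial.X i : P n) • homPre l (x : P n) := by
  let f : X.I →ₗ[ℂ] X.A := homPre l ∘ₗ (X.I.subtype.restrictScalars ℂ) ∘ₗ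
    ((LinearMap.lsmul (P n) X.I (MvPolynomial.X i)).restrictScalars ℂ)
  let g : X.I →ₗ[ℂ] X.A := ((LinearMap.lsmul (P n) X.A (MvPolynomial.X i)).restrictScalars ℂ) ∘ₗ
    homPre l ∘ₗ (X.I.subtype.restrictScalars ℂ)
  suffices h : f = g from LinearMap.congr_fun h x
  refine LinearMap.ext_on span_monI ?_
  rintro _ ⟨m, hm, rfl⟩
  have hle : m ≤ Finsupp.single i 1 + m := le_add_self
  have hm' : (Finsupp.single i 1 + m).support ∉ X.faces :=
    fun h => hm (X.down_closed h (support_mono' hle))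
  change homPre l (((MvPolynomial.X i : P n) • (monI m hm) : X.I) : P n) =
    (MvPolynomial.X i : P n) • homPre l (monI m hm : P n)
  rw [X_smul_monI i m hm hm', homPre_monI, homPre_monI, smul_comm]
  by_cases hg : X.Good a b (Finsupp.single i 1 + m)
  · have hc := hg.core_mem hab
    have hcm : core a b m.support ∪ core a b (Finsupp.single i 1 + m).support =
        core a b (Finsupp.single i 1 + m).support :=
      Finset.union_eq_right.2 (core_mono (support_mono' hle))
    have hc' : core a b m.support ∈ X.faces :=
      X.down_closed hc (core_mono (support_mono' hle))
    have hE := ev0_congr hl (core_mem_N hab hm hc') (core_mem_N hab hm' hc) (by rwa [hcm])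
    by_cases hb : b ⊆ m.support
    · rw [X_smul_shiftMon hb, hE]
    -- Here x^m has no shift but x_i x^m does. The core of m lies in Ñ, so both scalars are 0.
    · rw [← hE, ev0_eq_zero hl.1 (core_mem_NTilde hab hm hc' hb), zero_smul, zero_smul]
  · rw [shiftMon_of_not_good hg, smul_zero]
    by_cases hb : b ⊆ m.support
    · rw [X_smul_shiftMon hb, shiftMon_of_not_good hg, smul_zero]
    · rw [shiftMon_of_not_good fun h => hb h.1, smul_zero, smul_zero]

/-- The homomorphism `I_X → A_X` given by a `0`-cocycle. -/
def homOf (hab : Disjoint a.support b) (l : X.Z a b 0) : X.I →ₗ[P n] X.A where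
  toFun x := homPre l.1 (x : P n)
  map_add' x y := by simp
  map_smul' s x := map_smul_of_forall_X (homPre l.1 ∘ₗ (X.I.subtype.restrictScalars ℂ))
    (homPre_X_smul hab l.2) s x

theorem homOf_monI (hab : Disjoint a.support b) (l : X.Z a b 0) (m : Fin (n + 1) →₀ ℕ)
    (hm : m.support ∉ X.faces) :
    homOf hab l (monI m hm) = ev0 _ (core a b m.support) l.1 • X.shiftMon a b m :=
  homPre_monI _ _ _

theorem homOf_mem (hab : Disjoint a.support b) (l : X.Z a b 0) :
    homOf hab l ∈ X.homDeg (shift a b) := by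
  intro d x hx
  refine monoMap_mem _ _ fun m hm => Submodule.smul_mem _ _ (shiftMon_mem fun i => ?_)
  exact (mem_gradedP_iff.1 hx m hm i).symm

variable (X) in
/-- `λ ↦ homOf λ` as a linear map. -/
def homMap (hab : Disjoint a.support b) : X.Z a b 0 →ₗ[ℂ] X.homDeg (shift a b) where
  toFun l := ⟨homOf hab l, homOf_mem hab l⟩
  map_add' l l' := Subtype.ext <| homI_ext fun m hm => by
    change homOf hab (l + l') _ = homOf hab l _ + homOf hab l' _
    rw [homOf_monI, homOf_monI, homOf_monI, ← add_smul, Submodule.coe_add, map_add]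
  map_smul' t l := Subtype.ext <| homI_ext fun m hm => by
    change homOf hab (t • l) _ = t • homOf hab l _
    rw [homOf_monI, homOf_monI, Submodule.coe_smul, map_smul, smul_assoc]

theorem homDeg_monI (hab : Disjoint a.support b) {φ : X.I →ₗ[P n] X.A}
    (hφ : φ ∈ X.homDeg (shift a b)) (m : Fin (n + 1) →₀ ℕ) (hm : m.support ∉ X.faces) :
    φ (monI m hm) = X.shiftCoeff a b m (φ (monI m hm)) • X.shiftMon a b m :=
  eq_shiftCoeff_smul hab (fun _ => rfl)
    (hφ _ (monI m hm) (monomial_mem_gradedP 1 fun _ => rfl))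

theorem monomial_smul_monI {m m' : Fin (n + 1) →₀ ℕ} (h : m ≤ m') (hm : m.support ∉ X.faces)
    (hm' : m'.support ∉ X.faces) :
    (monI m' hm' : X.I) = (monomial (m' - m) 1 : P n) • (monI m hm : X.I) :=
  Subtype.ext (by
    rw [Submodule.coe_smul, smul_eq_mul, monI, monI, monomial_mul, tsub_add_cancel_of_le h, one_mul])

theorem shiftCoeff_hom_mono {φ : X.I →ₗ[P n] X.A} {m m' : Fin (n + 1) →₀ ℕ} (h : m ≤ m')
    (hm : m.support ∉ X.faces) (hm' : m'.support ∉ X.faces) (hb : b ⊆ m.support)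
    (hg : X.Good a b m') :
    X.shiftCoeff a b m' (φ (monI m' hm')) = X.shiftCoeff a b m (φ (monI m hm)) := by
  rw [monomial_smul_monI h hm hm', map_smul]
  have := shiftCoeff_monomial_smul (u := m' - m) hb (by rwa [tsub_add_cancel_of_le h])
    (φ (monI m hm))
  rwa [tsub_add_cancel_of_le h] at this

theorem shiftCoeff_hom_eq_zero (hab : Disjoint a.support b) {φ : X.I →ₗ[P n] X.A}
    {m m' : Fin (n + 1) →₀ ℕ} (h : m ≤ m')
    (hm : m.support ∉ X.faces) (hm' : m'.support ∉ X.faces) (hb : ¬ b ⊆ m.support)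
    (hg : X.Good a b m') :
    X.shiftCoeff a b m' (φ (monI m' hm')) = 0 := by
  rw [monomial_smul_monI h hm hm', map_smul]
  have := shiftCoeff_monomial_smul_eq_zero (u := m' - m) hab hb
    (by rwa [tsub_add_cancel_of_le h]) (φ (monI m hm))
  rwa [tsub_add_cancel_of_le h] at this

/-- The value λ(f) is read off at x^{f ∪ b}, whose core is f and whose shift is nonzero. -/
theorem homMap_injective (hab : Disjoint a.support b) :
    Function.Injective (X.homMap hab) := by
  rw [injective_iff_map_eq_zero]
  intro l hl
  refine Subtype.ext (ext_ev0 fun f hf => ?_)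
  have hs : (ind (f ∪ b)).support ∉ X.faces := by rw [support_ind]; exact hf.2.2.2
  have hg : X.Good a b (ind (f ∪ b)) := good_ind hf.1 hf.2.1
  have h1 := LinearMap.congr_fun (congrArg Subtype.val hl) (monI _ hs)
  change homOf hab l _ = 0 at h1
  rw [homOf_monI] at h1
  have h2 := (smul_eq_zero.1 h1).resolve_right (shiftMon_ne_zero hg)
  have h3 : core a b (f ∪ b) = f := by
    have h4 := Finset.disjoint_left.1 (Finset.disjoint_iff_inter_eq_empty.2 hf.2.2.1)
    have h5 := hf.2.1
    unfold core; grind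
  rw [support_ind, h3] at h2
  rw [h2]; simp

-- The cochain is the coefficient of φ at x^{f ∪ b}. Monotonicity, applied to f and g inside f ∪ g,
-- gives the cocycle condition; over Ñ the monomial x^{f ∪ b} is a multiple of some x^p in I_X with
-- b not contained in p, which gives the vanishing.
open scoped Classical in
theorem homMap_surjective (hab : Disjoint a.support b) :
    Function.Surjective (X.homMap hab) := by
  rintro ⟨φ, hφ⟩
  let L : Finset (Fin (n + 1)) → ℂ := fun f =>
    if hf : (ind (f ∪ b)).support ∉ X.faces then
      X.shiftCoeff a b (ind (f ∪ b)) (φ (monI _ hf)) else 0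
  have hN : ∀ f ∈ (X.N a.support b).carrier, (ind (f ∪ b)).support ∉ X.faces := fun f hf => by
    rw [support_ind]; exact hf.2.2.2
  have hL : ∀ f hf, L f = X.shiftCoeff a b (ind (f ∪ b)) (φ (monI _ hf)) :=
    fun f hf => dif_pos hf
  have hmono : ∀ f g, f ∈ (X.N a.support b).carrier → g ∈ (X.N a.support b).carrier →
      f ⊆ g → L f = L g := by
    intro f g hf hg hfg
    rw [hL f (hN f hf), hL g (hN g hg)]
    exact (shiftCoeff_hom_mono (ind_mono (Finset.union_subset_union_left hfg)) _ _ (by simp)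
      (good_ind hg.1 hg.2.1)).symm
  have hl : (fun t : (X.N a.support b).Tuple 0 => L (t.1 0)) ∈ X.Z a b 0 := by
    refine mem_cocycles_zero (fun f hf => ?_) fun f g hf hg hfg => ?_
    · obtain ⟨p, hp1, hp2, hp3⟩ := exists_nonface hf.1
      rw [hL f (hN f hf.1)]
      refine shiftCoeff_hom_eq_zero hab (m := ind p.1) (ind_mono hp1) ?_ _ ?_
        (good_ind hf.1.1 hf.1.2.1)
      · rw [support_ind]; exact p.2
      · rw [support_ind]; exact hp3 hf
    · have hfg' := (X.N a.support b).union_mem hf hg hfg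
      rw [hmono f _ hf hfg' Finset.subset_union_left, hmono g _ hg hfg' Finset.subset_union_right]
  refine ⟨⟨_, hl⟩, Subtype.ext (homI_ext fun m hm => ?_)⟩
  change homOf hab _ _ = φ _
  rw [homOf_monI, homDeg_monI hab hφ]
  by_cases hg : X.Good a b m
  · have hc := hg.core_mem hab
    have hcN := core_mem_N hab hm hc
    refine (congrArg (· • X.shiftMon a b m) (ev0_mk L hcN)).trans ?_
    rw [hL _ (hN _ hcN)]
    congr 1
    -- The exponents m and core ∪ b are compared through their least common multiple. Its shift is
    -- nonzero: on b the exponents are those of m, already at least 1, and off b the core adds only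
    -- points of a.
    have hcg : X.Good a b (m ⊔ ind (core a b m.support ∪ b)) := by
      have hb := hg.1
      refine ⟨hb.trans (support_mono' le_sup_left), X.down_closed hg.2 fun i hi => ?_⟩
      have hd := fun h : i ∈ a.support => Finset.disjoint_left.1 hab h
      simp only [Finsupp.mem_support_iff, Finsupp.coe_tsub, Finsupp.coe_add, Pi.sub_apply,
        Pi.add_apply, ind_apply, core, Finset.mem_union, Finset.mem_sdiff,
        Finsupp.sup_apply] at hi hd ⊢
      have hbi := @hb i
      simp only [Finsupp.mem_support_iff] at hbi
      grind
    have hne : (m ⊔ ind (core a b m.support ∪ b)).support ∉ X.faces :=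
      fun h => hm (X.down_closed h (support_mono' le_sup_left))
    rw [← shiftCoeff_hom_mono (φ := φ) le_sup_left hm hne hg.1 hcg,
      ← shiftCoeff_hom_mono (φ := φ) le_sup_right (hN _ hcN) hne (by simp) hcg]
  · rw [shiftMon_of_not_good hg, smul_zero, smul_zero]

theorem nonempty_homDeg_equiv (hab : Disjoint a.support b) :
    Nonempty (X.homDeg (shift a b) ≃ₗ[ℂ] H (X.NTilde_subset_N a.support b) 0) := by
  -- The kernel complex starts in degree 0, so its H⁰ is the space of cocycles itself.
  have h0 : (coboundaries (X.NTilde_subset_N a.support b) 0).submoduleOf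
      (cocycles (X.NTilde_subset_N a.support b) 0) = ⊥ := by
    rw [Submodule.submoduleOf, coboundaries, Submodule.comap_bot, Submodule.ker_subtype]
  exact ⟨(LinearEquiv.ofBijective _ ⟨homMap_injective hab, homMap_surjective hab⟩).symm ≪≫ₗ
    (Submodule.quotEquivOfEqBot _ h0).symm⟩

end

section

variable {n : ℕ} {X : FaceComplex n}

/-! ### Taylor relations -/

theorem sub_add_ind {m : Fin (n + 1) →₀ ℕ} {s : Finset (Fin (n + 1))} (h : s ⊆ m.support) :
    m - ind s + ind s = m := tsub_add_cancel_of_le (ind_le_iff.2 h)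

/-- The relation `x^{m - p} e_p - x^{m - q} e_q`. -/
def taylor (m : Fin (n + 1) →₀ ℕ) (p q : X.Nonface) (hp : p.1 ⊆ m.support)
    (hq : q.1 ⊆ m.support) : Cotangent.Rel X.gen :=
  ⟨Pi.single p (monomial (m - ind p.1) 1) - Pi.single q (monomial (m - ind q.1) 1), by
    rw [LinearMap.mem_ker, map_sub, Fintype.linearCombination_apply_single,
      Fintype.linearCombination_apply_single, gen_eq, gen_eq, smul_eq_mul, smul_eq_mul,
      monomial_mul, monomial_mul, sub_add_ind hp, sub_add_ind hq, sub_self]⟩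

theorem coe_taylor (m : Fin (n + 1) →₀ ℕ) (p q : X.Nonface) (hp : p.1 ⊆ m.support)
    (hq : q.1 ⊆ m.support) : (taylor m p q hp hq : X.Nonface → P n) =
      Pi.single p (monomial (m - ind p.1) 1) - Pi.single q (monomial (m - ind q.1) 1) := rfl

theorem taylor_relDeg (m : Fin (n + 1) →₀ ℕ) (p q : X.Nonface) (hp : p.1 ⊆ m.support)
    (hq : q.1 ⊆ m.support) : X.RelDeg (fun i => (m i : ℤ)) (taylor m p q hp hq) := by
  have key : ∀ (p r : X.Nonface), p.1 ⊆ m.support →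
      (Pi.single p (monomial (m - ind p.1) 1) : X.Nonface → P n) r ∈
        gradedP ((fun i => (m i : ℤ)) - char r.1) := by
    intro p r hp
    by_cases h : r = p
    · subst h
      rw [Pi.single_eq_same]
      refine monomial_mem_gradedP _ fun i => ?_
      have := ind_le_iff.2 hp i
      simp only [ind_apply] at this
      simp only [Finsupp.coe_tsub, Pi.sub_apply, ind_apply, char]
      split_ifs at this ⊢ <;> omega
    · rw [Pi.single_eq_of_ne h]
      exact zero_mem _
  intro r
  exact sub_mem (key p r hp) (key q r hq)

theorem monomial_smul_taylor {m m' : Fin (n + 1) →₀ ℕ} {p q : X.Nonface} (h : m ≤ m')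
    (hp : p.1 ⊆ m.support) (hq : q.1 ⊆ m.support) (hp' : p.1 ⊆ m'.support)
    (hq' : q.1 ⊆ m'.support) :
    taylor m' p q hp' hq' = (monomial (m' - m) 1 : P n) • taylor m p q hp hq := by
  refine Subtype.ext ?_
  have key : ∀ s : X.Nonface, s.1 ⊆ m.support → m' - m + (m - ind s.1) = m' - ind s.1 :=
    fun s hs => tsub_add_tsub_cancel h (ind_le_iff.2 hs)
  rw [Submodule.coe_smul, taylor, taylor, smul_sub, ← Pi.single_smul, ← Pi.single_smul,
    smul_eq_mul, smul_eq_mul, monomial_mul, monomial_mul, key p hp, key q hq, one_mul]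

theorem taylor_add_taylor {m : Fin (n + 1) →₀ ℕ} {p q r : X.Nonface}
    (hp : p.1 ⊆ m.support) (hq : q.1 ⊆ m.support) (hr : r.1 ⊆ m.support) :
    taylor m p q hp hq + taylor m q r hq hr = taylor m p r hp hr :=
  Subtype.ext (sub_add_sub_cancel _ _ _)

section freeMap

variable {M : Type*} [AddCommGroup M] [Module ℂ M]

/-- The `ℂ`-linear map on `P^{Δ_n ∖ X}` with prescribed values on monomials. -/
def freeMap (f : X.Nonface → (Fin (n + 1) →₀ ℕ) → M) : (X.Nonface → P n) →ₗ[ℂ] M :=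
  ∑ p, monoMap (f p) ∘ₗ LinearMap.proj p

theorem freeMap_single (f : X.Nonface → (Fin (n + 1) →₀ ℕ) → M) (p : X.Nonface)
    (u : Fin (n + 1) →₀ ℕ) : freeMap f (Pi.single p (monomial u 1)) = f p u := by
  rw [freeMap, LinearMap.sum_apply, Finset.sum_eq_single p]
  · rw [LinearMap.comp_apply, LinearMap.proj_apply, Pi.single_eq_same, monoMap_monomial_one]
  · intro q _ hq
    rw [LinearMap.comp_apply, LinearMap.proj_apply, Pi.single_eq_of_ne hq, map_zero]
  · intro h; exact absurd (Finset.mem_univ p) h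

end freeMap

theorem eq_top_of_single_mem (S : Submodule ℂ (X.Nonface → P n))
    (h : ∀ (p : X.Nonface) u, (Pi.single p (monomial u 1) : X.Nonface → P n) ∈ S) : S = ⊤ := by
  rw [eq_top_iff]
  rintro x -
  rw [← Finset.univ_sum_single x]
  refine S.sum_mem fun p _ => ?_
  have : x p ∈ S.comap (LinearMap.single ℂ (fun _ : X.Nonface => P n) p) := by
    rw [(x p).as_sum]
    refine Submodule.sum_mem _ fun m _ => ?_
    rw [← mul_one (coeff m (x p)), ← smul_eq_mul, ← smul_monomial]
    exact Submodule.smul_mem _ _ (h p m)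
  exact this

open scoped Classical in
/-- The `ℂ`-linear map `x^m ↦ x^{m - s} e_s`, where `s` is the support of `m`. -/
def supportLift (X : FaceComplex n) : P n →ₗ[ℂ] (X.Nonface → P n) :=
  monoMap fun m => if h : m.support ∉ X.faces then
    Pi.single ⟨m.support, h⟩ (monomial (m - ind m.support) 1) else 0

/-- The Taylor relations span the module of relations over `ℂ`. -/
theorem span_taylor : Submodule.span ℂ
    {r : Cotangent.Rel X.gen | ∃ m p q hp hq, r = taylor m p q hp hq} = ⊤ := by
  rw [eq_top_iff]
  rintro r -
  set T := Submodule.span ℂ {r : Cotangent.Rel X.gen | ∃ m p q hp hq, r = taylor m p q hp hq}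
  let S : Submodule ℂ (X.Nonface → P n) := T.map ((Cotangent.Rel X.gen).subtype.restrictScalars ℂ)
  -- D fixes every relation, because j vanishes there, and it sends x^u e_p to the Taylor relation
  -- between p and the support of u + p. So its image consists of combinations of Taylor relations.
  let D : (X.Nonface → P n) →ₗ[ℂ] (X.Nonface → P n) :=
    LinearMap.id - supportLift X ∘ₗ (Cotangent.pres X.gen).restrictScalars ℂ
  have hD : S.comap D = ⊤ := by
    refine eq_top_of_single_mem _ fun p u => ?_
    have hp : p.1 ⊆ (u + ind p.1).support :=
      (support_ind p.1).symm.subset.trans (support_mono' le_add_self)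
    have hs : (u + ind p.1).support ∉ X.faces := fun h => p.2 (X.down_closed h hp)
    refine ⟨taylor (u + ind p.1) p ⟨_, hs⟩ hp subset_rfl,
      Submodule.subset_span ⟨_, _, _, _, _, rfl⟩, ?_⟩
    change Pi.single p _ - Pi.single _ _ = Pi.single p _ - supportLift X (Cotangent.pres X.gen _)
    rw [Fintype.linearCombination_apply_single, gen_eq, smul_eq_mul, monomial_mul, one_mul,
      supportLift, monoMap_monomial_one, dif_pos hs, add_tsub_cancel_right]
  have hr : D r ∈ S := by
    have : (r : X.Nonface → P n) ∈ S.comap D := hD ▸ Submodule.mem_top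
    exact this
  have hDr : D r = r := by
    change (r : X.Nonface → P n) - supportLift X (Cotangent.pres X.gen r) = r
    rw [LinearMap.mem_ker.1 r.2, map_zero, sub_zero]
  rw [hDr] at hr
  obtain ⟨y, hy, hxy⟩ := hr
  rwa [← Subtype.ext hxy]

theorem rel_ext {M : Type*} [AddCommGroup M] [Module ℂ M]
    {f g : Cotangent.Rel X.gen →ₗ[ℂ] M}
    (h : ∀ m p q hp hq, f (taylor m p q hp hq) = g (taylor m p q hp hq)) : f = g := by
  refine LinearMap.ext_on span_taylor ?_
  rintro _ ⟨m, p, q, hp, hq, rfl⟩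
  exact h m p q hp hq

/-- The class of a Taylor relation modulo Koszul relations. -/
def taylorMk (m : Fin (n + 1) →₀ ℕ) (p q : X.Nonface) (hp : p.1 ⊆ m.support)
    (hq : q.1 ⊆ m.support) : Cotangent.Rel X.gen ⧸ Cotangent.koszul X.gen :=
  Submodule.Quotient.mk (taylor m p q hp hq)

theorem relHom_ext {ψ ψ' : Cotangent.RelHom X.gen}
    (h : ∀ m p q hp hq, ψ (taylorMk m p q hp hq) = ψ' (taylorMk m p q hp hq)) : ψ = ψ' := by
  have h1 : (ψ ∘ₗ (Cotangent.koszul X.gen).mkQ).restrictScalars ℂ =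
      (ψ' ∘ₗ (Cotangent.koszul X.gen).mkQ).restrictScalars ℂ := rel_ext h
  refine Submodule.linearMap_qext _ (LinearMap.ext fun x => LinearMap.congr_fun h1 x)

theorem taylorMk_smul {m m' : Fin (n + 1) →₀ ℕ} {p q : X.Nonface} (h : m ≤ m')
    (hp : p.1 ⊆ m.support) (hq : q.1 ⊆ m.support) (hp' : p.1 ⊆ m'.support)
    (hq' : q.1 ⊆ m'.support) :
    taylorMk m' p q hp' hq' = (monomial (m' - m) 1 : P n) • taylorMk m p q hp hq := by
  rw [taylorMk, monomial_smul_taylor h hp hq hp' hq']; rfl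

theorem taylorMk_add {m : Fin (n + 1) →₀ ℕ} {p q r : X.Nonface}
    (hp : p.1 ⊆ m.support) (hq : q.1 ⊆ m.support) (hr : r.1 ⊆ m.support) :
    taylorMk m p q hp hq + taylorMk m q r hq hr = taylorMk m p r hp hr := by
  rw [taylorMk, taylorMk, taylorMk, ← taylor_add_taylor hp hq hr]; rfl

theorem taylor_koszul (p q : X.Nonface) (hp : p.1 ⊆ (ind p.1 + ind q.1).support)
    (hq : q.1 ⊆ (ind p.1 + ind q.1).support) :
    (taylor (ind p.1 + ind q.1) p q hp hq : X.Nonface → P n) =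
      Cotangent.pres X.gen (Pi.single q 1) • Pi.single p 1 -
      Cotangent.pres X.gen (Pi.single p 1) • Pi.single q 1 := by
  rw [coe_taylor, Fintype.linearCombination_apply_single, Fintype.linearCombination_apply_single,
    one_smul, one_smul, gen_eq, gen_eq, ← Pi.single_smul, ← Pi.single_smul, smul_eq_mul, mul_one,
    smul_eq_mul, mul_one, add_tsub_cancel_left, add_tsub_cancel_right]

theorem taylorMk_koszul (p q : X.Nonface) (hp : p.1 ⊆ (ind p.1 + ind q.1).support)
    (hq : q.1 ⊆ (ind p.1 + ind q.1).support) : taylorMk (ind p.1 + ind q.1) p q hp hq = 0 := by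
  rw [taylorMk, Submodule.Quotient.mk_eq_zero]
  exact Submodule.subset_span ⟨_, _, taylor_koszul p q hp hq⟩

/-- A `P`-linear map on relations vanishes on Koszul relations if it does so for those of two
generators. -/
theorem koszul_le_ker {M : Type*} [AddCommGroup M] [Module (P n) M]
    (f : Cotangent.Rel X.gen →ₗ[P n] M)
    (h : ∀ p q hp hq, f (taylor (ind p.1 + ind q.1) p q hp hq) = 0) :
    Cotangent.koszul X.gen ≤ LinearMap.ker f := by
  have hm : ∀ u v : X.Nonface → P n,
      Cotangent.pres X.gen u • v - Cotangent.pres X.gen v • u ∈ Cotangent.Rel X.gen := by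
    intro u v
    rw [LinearMap.mem_ker, map_sub, map_smul, map_smul, smul_eq_mul, smul_eq_mul, mul_comm,
      sub_self]
  -- The Koszul expression is bilinear in u and v, so vanishing can be checked on pairs of basis
  -- vectors.
  let B : (X.Nonface → P n) →ₗ[P n] (X.Nonface → P n) →ₗ[P n] M :=
    LinearMap.mk₂ (P n) (fun u v => f ⟨_, hm u v⟩)
      (fun u u' v => by
        rw [← map_add]; congr 1; refine Subtype.ext ?_
        simp only [Submodule.coe_add, map_add, add_smul, smul_add]; abel)
      (fun s u v => by
        rw [← map_smul]; congr 1; refine Subtype.ext ?_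
        simp only [Submodule.coe_smul, map_smul, smul_sub, smul_smul, smul_eq_mul]
        rw [mul_comm (Cotangent.pres X.gen v) s])
      (fun u v v' => by
        rw [← map_add]; congr 1; refine Subtype.ext ?_
        simp only [Submodule.coe_add, map_add, add_smul, smul_add]; abel)
      (fun s u v => by
        rw [← map_smul]; congr 1; refine Subtype.ext ?_
        simp only [Submodule.coe_smul, map_smul, smul_sub, smul_smul, smul_eq_mul]
        rw [mul_comm (Cotangent.pres X.gen u) s])
  have hB : B = 0 := by
    refine LinearMap.pi_ext' fun q => LinearMap.ext_ring (LinearMap.pi_ext' fun p =>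
      LinearMap.ext_ring ?_)
    have hp : p.1 ⊆ (ind p.1 + ind q.1).support :=
      (support_ind p.1).symm.subset.trans (support_mono' le_self_add)
    have hq : q.1 ⊆ (ind p.1 + ind q.1).support :=
      (support_ind q.1).symm.subset.trans (support_mono' le_add_self)
    change f ⟨_, hm (Pi.single q 1) (Pi.single p 1)⟩ = 0
    rw [← h p q hp hq]
    exact congrArg f (Subtype.ext (taylor_koszul p q hp hq).symm)
  refine Submodule.span_le.2 ?_
  rintro r ⟨u, v, hr⟩
  have : B u v = 0 := by rw [hB]; rfl
  rw [SetLike.mem_coe, LinearMap.mem_ker, ← this]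
  exact congrArg f (Subtype.ext hr)

end

section

variable {n : ℕ} {X : FaceComplex n} {a : Fin (n + 1) →₀ ℕ} {b : Finset (Fin (n + 1))}

/-! ### Homomorphisms on relations given by `1`-cocycles -/

theorem Good.core_subset_mem (hab : Disjoint a.support b) {m : Fin (n + 1) →₀ ℕ}
    (hm : X.Good a b m) {s : Finset (Fin (n + 1))} (hs : s ⊆ m.support) :
    core a b s ∈ X.faces := X.down_closed (hm.core_mem hab) (core_mono hs)

theorem Good.core_mem_N (hab : Disjoint a.support b) {m : Fin (n + 1) →₀ ℕ}
    (hm : X.Good a b m) {p : X.Nonface} (hp : p.1 ⊆ m.support) :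
    core a b p.1 ∈ (X.N a.support b).carrier :=
  FaceComplex.core_mem_N hab p.2 (hm.core_subset_mem hab hp)

theorem Good.core_mem_NTilde (hab : Disjoint a.support b) {m : Fin (n + 1) →₀ ℕ}
    (hm : X.Good a b m) {p : X.Nonface} (hp : p.1 ⊆ m.support) (hb : ¬ b ⊆ p.1) :
    core a b p.1 ∈ (X.NTilde a.support b).carrier :=
  FaceComplex.core_mem_NTilde hab p.2 (hm.core_subset_mem hab hp) hb

/-- The map `x^u e_p ↦ λ(core p, core s) x^{u + p + a - b}`, where `s` is the support of
`u + p`. -/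
def relPre (l : (X.N a.support b).Tuple 1 → ℂ) : (X.Nonface → P n) →ₗ[ℂ] X.A :=
  freeMap fun p u => ev1 _ (core a b p.1) (core a b (u + ind p.1).support) l •
    X.shiftMon a b (u + ind p.1)

/-- The support of m is an auxiliary third nonface containing p and q; the cocycle identity cancels
it. On the whole free module the formula need not be P-linear, but on relations it is. -/
theorem relPre_taylor (hab : Disjoint a.support b) {l : (X.N a.support b).Tuple 1 → ℂ}
    (hl : l ∈ X.Z a b 1) (m : Fin (n + 1) →₀ ℕ) (p q : X.Nonface) (hp : p.1 ⊆ m.support)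
    (hq : q.1 ⊆ m.support) :
    relPre l (taylor m p q hp hq) = ev1 _ (core a b p.1) (core a b q.1) l • X.shiftMon a b m := by
  rw [coe_taylor, map_sub, relPre, freeMap_single, freeMap_single, sub_add_ind hp, sub_add_ind hq]
  by_cases hg : X.Good a b m
  · have hs : m.support ∉ X.faces := fun h => p.2 (X.down_closed h hp)
    rw [← sub_smul, ← ev1_add hl (hg.core_mem_N hab hp) (hg.core_mem_N hab hq)
      (hg.core_mem_N hab (p := ⟨_, hs⟩) subset_rfl), add_sub_cancel_right]
    exact X.down_closed (hg.core_mem hab) (Finset.union_subset (core_mono hp)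
      (Finset.union_subset (core_mono hq) subset_rfl))
  · rw [shiftMon_of_not_good hg, smul_zero, smul_zero, smul_zero, sub_zero]

theorem relPre_X_smul (hab : Disjoint a.support b) {l : (X.N a.support b).Tuple 1 → ℂ}
    (hl : l ∈ X.Z a b 1) (i : Fin (n + 1)) (r : Cotangent.Rel X.gen) :
    relPre l (((MvPolynomial.X i : P n) • r : Cotangent.Rel X.gen) : X.Nonface → P n)
      = (MvPolynomial.X i : P n) • relPre l (r : X.Nonface → P n) := by
  let f : Cotangent.Rel X.gen →ₗ[ℂ] X.A :=
    relPre l ∘ₗ ((Cotangent.Rel X.gen).subtype.restrictScalars ℂ) ∘ₗ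
    ((LinearMap.lsmul (P n) (Cotangent.Rel X.gen) (MvPolynomial.X i)).restrictScalars ℂ)
  let g : Cotangent.Rel X.gen →ₗ[ℂ] X.A :=
    ((LinearMap.lsmul (P n) X.A (MvPolynomial.X i)).restrictScalars ℂ) ∘ₗ
    relPre l ∘ₗ ((Cotangent.Rel X.gen).subtype.restrictScalars ℂ)
  suffices h : f = g from LinearMap.congr_fun h r
  refine rel_ext fun m p q hp hq => ?_
  have hle : m ≤ Finsupp.single i 1 + m := le_add_self
  have hp' := hp.trans (support_mono' hle)
  have hq' := hq.trans (support_mono' hle)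
  change relPre l (((MvPolynomial.X i : P n) • taylor m p q hp hq : Cotangent.Rel X.gen) :
    X.Nonface → P n) = (MvPolynomial.X i : P n) • relPre l (taylor m p q hp hq)
  have hX : (MvPolynomial.X i : P n) • taylor m p q hp hq =
      taylor (Finsupp.single i 1 + m) p q hp' hq' := by
    rw [monomial_smul_taylor hle hp hq hp' hq', add_tsub_cancel_right]; rfl
  rw [hX, relPre_taylor hab hl, relPre_taylor hab hl, smul_comm]
  by_cases hb : b ⊆ m.support
  · rw [X_smul_shiftMon hb]
  · rw [shiftMon_of_not_good fun h => hb h.1, smul_zero, smul_zero]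
    by_cases hg : X.Good a b (Finsupp.single i 1 + m)
    -- Neither p nor q contains b, as m does not; both cores therefore lie in Ñ.
    · rw [ev1_eq_zero hl.1 (hg.core_mem_NTilde hab hp' fun h => hb (h.trans hp))
        (hg.core_mem_NTilde hab hq' fun h => hb (h.trans hq)), zero_smul]
    · rw [shiftMon_of_not_good hg, smul_zero]

/-- The `P`-linear map on relations given by a `1`-cocycle. -/
def relLin (hab : Disjoint a.support b) (l : X.Z a b 1) : Cotangent.Rel X.gen →ₗ[P n] X.A where
  toFun r := relPre l.1 (r : X.Nonface → P n)
  map_add' x y := by simp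
  map_smul' s x := map_smul_of_forall_X
    (relPre l.1 ∘ₗ ((Cotangent.Rel X.gen).subtype.restrictScalars ℂ))
    (relPre_X_smul hab l.2) s x

theorem relLin_taylor (hab : Disjoint a.support b) (l : X.Z a b 1) (m : Fin (n + 1) →₀ ℕ)
    (p q : X.Nonface) (hp : p.1 ⊆ m.support) (hq : q.1 ⊆ m.support) :
    relLin hab l (taylor m p q hp hq) =
      ev1 _ (core a b p.1) (core a b q.1) l.1 • X.shiftMon a b m :=
  relPre_taylor hab l.2 m p q hp hq

/-- If b ⊆ q, then the shift of x^p x^q is still divisible by x^p: every point of b in p has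
exponent 2 before the shift. It would be 0 in `A_X`. So a nonzero shift forces b to lie in neither p
nor q, and λ vanishes on the two cores. -/
theorem relLin_koszul (hab : Disjoint a.support b) (l : X.Z a b 1) :
    Cotangent.koszul X.gen ≤ LinearMap.ker (relLin hab l) := by
  refine koszul_le_ker _ fun p q hp hq => ?_
  rw [relLin_taylor]
  by_cases hg : X.Good a b (ind p.1 + ind q.1)
  · have hsub : p.1 ∪ q.1 ⊆ (ind p.1 + ind q.1).support := Finset.union_subset hp hq
    have key : ∀ s : X.Nonface, s.1 ⊆ (ind p.1 + ind q.1 + a - ind b).support → False :=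
      fun s hs => s.2 (X.down_closed hg.2 hs)
    have hp1 : ¬ b ⊆ q.1 := by
      intro h
      refine key p fun i hi => ?_
      have := @h i
      simp only [Finsupp.mem_support_iff, Finsupp.coe_tsub, Finsupp.coe_add, Pi.sub_apply,
        Pi.add_apply, ind_apply, hi, if_true]
      split_ifs <;> first | omega | tauto
    have hq1 : ¬ b ⊆ p.1 := by
      intro h
      refine key q fun i hi => ?_
      have := @h i
      simp only [Finsupp.mem_support_iff, Finsupp.coe_tsub, Finsupp.coe_add, Pi.sub_apply,
        Pi.add_apply, ind_apply, hi, if_true]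
      split_ifs <;> first | omega | tauto
    rw [ev1_eq_zero l.2.1 (hg.core_mem_NTilde hab hp hq1) (hg.core_mem_NTilde hab hq hp1),
      zero_smul]
  · rw [shiftMon_of_not_good hg, smul_zero]

/-- The element of `Hom(R / R₀, A_X)` given by a `1`-cocycle. -/
def relOf (hab : Disjoint a.support b) (l : X.Z a b 1) : Cotangent.RelHom X.gen :=
  (Cotangent.koszul X.gen).liftQ (relLin hab l) (relLin_koszul hab l)

theorem relOf_taylorMk (hab : Disjoint a.support b) (l : X.Z a b 1) (m : Fin (n + 1) →₀ ℕ)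
    (p q : X.Nonface) (hp : p.1 ⊆ m.support) (hq : q.1 ⊆ m.support) :
    relOf hab l (taylorMk m p q hp hq) =
      ev1 _ (core a b p.1) (core a b q.1) l.1 • X.shiftMon a b m :=
  relPre_taylor hab l.2 m p q hp hq

theorem relOf_mem (hab : Disjoint a.support b) (l : X.Z a b 1) :
    relOf hab l ∈ X.relHomDeg (shift a b) := by
  intro d r hr
  change relPre l.1 (r : X.Nonface → P n) ∈ _
  rw [relPre, freeMap, LinearMap.sum_apply]
  refine Submodule.sum_mem _ fun p _ => ?_
  refine monoMap_mem _ _ fun u hu => Submodule.smul_mem _ _ (shiftMon_mem fun i => ?_)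
  have := mem_gradedP_iff.1 (hr p) u hu i
  simp only [Pi.sub_apply, char] at this
  simp only [Finsupp.coe_add, Pi.add_apply, ind_apply]
  split_ifs at this ⊢ <;> omega

variable (X) in
/-- `λ ↦ relOf λ` as a linear map to the degree `a - b` part of `T²`. -/
def relMap (hab : Disjoint a.support b) : X.Z a b 1 →ₗ[ℂ] X.T2Deg (shift a b) where
  toFun l := ⟨(LinearMap.range (Cotangent.relRestrict X.gen)).mkQ (relOf hab l),
    ⟨_, relOf_mem hab l, rfl⟩⟩
  map_add' l l' := Subtype.ext <| by
    have : relOf hab (l + l') = relOf hab l + relOf hab l' := relHom_ext fun m p q hp hq => by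
      rw [LinearMap.add_apply, relOf_taylorMk, relOf_taylorMk, relOf_taylorMk, ← add_smul,
        Submodule.coe_add, map_add]
    exact (congrArg (LinearMap.range (Cotangent.relRestrict X.gen)).mkQ this).trans (map_add _ _ _)
  map_smul' t l := Subtype.ext <| by
    have : relOf hab (t • l) = t • relOf hab l := relHom_ext fun m p q hp hq => by
      rw [LinearMap.smul_apply, relOf_taylorMk, relOf_taylorMk, Submodule.coe_smul, map_smul,
        smul_assoc]
    exact (congrArg (LinearMap.range (Cotangent.relRestrict X.gen)).mkQ this).trans (LinearMap.map_smul_of_tower _ _ _)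

/-! ### Restrictions of homomorphisms on the free module -/

/-- The homomorphism `e_p ↦ μ_p x^{p + a - b}`. -/
def freeHom (a : Fin (n + 1) →₀ ℕ) (b : Finset (Fin (n + 1))) (μ : X.Nonface → ℂ) :
    (X.Nonface → P n) →ₗ[P n] X.A :=
  Fintype.linearCombination (P n) fun p => μ p • X.shiftMon a b (ind p.1)

/-- If b is not contained in p, then e_p maps to 0 whatever μ_p is. Hence μ_p has to be 0 for the
formula to hold in degrees with a nonzero shift. -/
theorem smul_freeHom_single (μ : X.Nonface → ℂ)
    {m : Fin (n + 1) →₀ ℕ} {p : X.Nonface} (hp : p.1 ⊆ m.support)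
    (hμ : X.Good a b m → ¬ b ⊆ p.1 → μ p = 0) :
    freeHom a b μ (Pi.single p (monomial (m - ind p.1) 1)) = μ p • X.shiftMon a b m := by
  rw [freeHom, Fintype.linearCombination_apply_single, smul_comm]
  by_cases hb : b ⊆ p.1
  · rw [monomial_smul_shiftMon (by rwa [support_ind]), sub_add_ind hp]
  · rw [shiftMon_of_not_good (m := ind p.1) fun h => hb (by simpa using h.1), smul_zero, smul_zero]
    by_cases hg : X.Good a b m
    · rw [hμ hg hb, zero_smul]
    · rw [shiftMon_of_not_good hg, smul_zero]

theorem relRestrict_freeHom (μ : X.Nonface → ℂ) (m : Fin (n + 1) →₀ ℕ) (p q : X.Nonface)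
    (hp : p.1 ⊆ m.support) (hq : q.1 ⊆ m.support)
    (hμ : ∀ p : X.Nonface, p.1 ⊆ m.support → X.Good a b m → ¬ b ⊆ p.1 → μ p = 0) :
    Cotangent.relRestrict X.gen (freeHom a b μ) (taylorMk m p q hp hq) =
      (μ p - μ q) • X.shiftMon a b m := by
  change freeHom a b μ (taylor m p q hp hq : X.Nonface → P n) = _
  rw [coe_taylor, map_sub, smul_freeHom_single μ hp (hμ p hp), smul_freeHom_single μ hq (hμ q hq),
    sub_smul]

theorem coboundaries_le_ker (hab : Disjoint a.support b) :
    (coboundaries (X.NTilde_subset_N a.support b) 1).submoduleOf (X.Z a b 1) ≤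
      LinearMap.ker (X.relMap hab) := by
  rintro l ⟨k, hk, hkl⟩
  rw [LinearMap.mem_ker]
  refine Subtype.ext ?_
  change (LinearMap.range (Cotangent.relRestrict X.gen)).mkQ (relOf hab l) = 0
  rw [Submodule.mkQ_apply, Submodule.Quotient.mk_eq_zero]
  -- The sign arises because (dk)(f, g) = k(g) - k(f), while restriction produces μ_p - μ_q.
  refine ⟨freeHom a b fun p => - ev0 _ (core a b p.1) k, relHom_ext fun m p q hp hq => ?_⟩
  rw [relRestrict_freeHom, relOf_taylorMk]
  · by_cases hg : X.Good a b m
    · have h : core a b p.1 ∈ (X.N a.support b).carrier ∧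
          core a b q.1 ∈ (X.N a.support b).carrier ∧ core a b p.1 ∪ core a b q.1 ∈ X.faces :=
        ⟨hg.core_mem_N hab hp, hg.core_mem_N hab hq, X.down_closed (hg.core_mem hab)
          (Finset.union_subset (core_mono hp) (core_mono hq))⟩
      have hkl' : (X.N a.support b).dFun 0 k = l.1 := hkl
      rw [← hkl', ev1_eq h, dFun_tuple1]
      congr 1
      ring
    · rw [shiftMon_of_not_good hg, smul_zero, smul_zero]
  · intro p hp hg hb
    rw [ev0_eq_zero hk (hg.core_mem_NTilde hab hp hb), neg_zero]

end

section

variable {n : ℕ} {X : FaceComplex n} {a : Fin (n + 1) →₀ ℕ} {b : Finset (Fin (n + 1))}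

/-! ### The degree `a - b` part of `T²` -/

/-- The coefficient of `x^{m + a - b}` in the value of `φ` at `x^{m - p} e_p`. -/
def freeCoeff (a : Fin (n + 1) →₀ ℕ) (b : Finset (Fin (n + 1)))
    (φ : (X.Nonface → P n) →ₗ[P n] X.A) (m : Fin (n + 1) →₀ ℕ) (p : X.Nonface) : ℂ :=
  X.shiftCoeff a b m (φ (Pi.single p (monomial (m - ind p.1) 1)))

theorem freeCoeff_mono (φ : (X.Nonface → P n) →ₗ[P n] X.A) {m m' : Fin (n + 1) →₀ ℕ}
    {p : X.Nonface} (h : m ≤ m') (hp : p.1 ⊆ m.support) (hb : b ⊆ m.support)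
    (hg : X.Good a b m') : freeCoeff a b φ m' p = freeCoeff a b φ m p := by
  have h1 : (Pi.single p (monomial (m' - ind p.1) 1) : X.Nonface → P n) =
      (monomial (m' - m) 1 : P n) • Pi.single p (monomial (m - ind p.1) 1) := by
    rw [← Pi.single_smul, smul_eq_mul, monomial_mul, one_mul,
      tsub_add_tsub_cancel h (ind_le_iff.2 hp)]
  have := shiftCoeff_monomial_smul (u := m' - m) hb (by rwa [tsub_add_cancel_of_le h])
    (φ (Pi.single p (monomial (m - ind p.1) 1)))
  rwa [tsub_add_cancel_of_le h, ← map_smul, ← h1] at this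

/-- The generator e_p has degree p, and p + a - b has a negative entry. The map φ need not be
homogeneous, since only one coefficient is extracted. -/
theorem freeCoeff_eq_zero (hab : Disjoint a.support b) (φ : (X.Nonface → P n) →ₗ[P n] X.A)
    {m : Fin (n + 1) →₀ ℕ} {p : X.Nonface} (hp : p.1 ⊆ m.support) (hb : ¬ b ⊆ p.1)
    (hg : X.Good a b m) : freeCoeff a b φ m p = 0 := by
  have h1 : (Pi.single p (monomial (m - ind p.1) 1) : X.Nonface → P n) =
      (monomial (m - ind p.1) 1 : P n) • Pi.single p 1 := by
    rw [← Pi.single_smul, smul_eq_mul, mul_one]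
  have := shiftCoeff_monomial_smul_eq_zero (m := ind p.1) (u := m - ind p.1) hab
    (by rwa [support_ind]) (by rwa [sub_add_ind hp]) (φ (Pi.single p 1))
  rwa [sub_add_ind hp, ← map_smul, ← h1] at this

/-- If φ restricts to the homomorphism of l, then l(core p, core q) is a difference of coefficients
of φ. Evaluated at the chosen nonfaces over N, these coefficients form, up to sign, a 0-cochain with
coboundary l. -/
theorem ker_le_coboundaries (hab : Disjoint a.support b) :
    LinearMap.ker (X.relMap hab) ≤
      (coboundaries (X.NTilde_subset_N a.support b) 1).submoduleOf (X.Z a b 1) := by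
  classical
  intro l hl
  have h0 : (LinearMap.range (Cotangent.relRestrict X.gen)).mkQ (relOf hab l) = 0 :=
    congrArg Subtype.val hl
  rw [Submodule.mkQ_apply, Submodule.Quotient.mk_eq_zero] at h0
  obtain ⟨φ, hφ⟩ := h0
  have hcoeff : ∀ m p q, p.1 ⊆ m.support → q.1 ⊆ m.support → X.Good a b m →
      ev1 _ (core a b p.1) (core a b q.1) l.1 = freeCoeff a b φ m p - freeCoeff a b φ m q := by
    intro m p q hp hq hg
    have h1 := LinearMap.congr_fun hφ (taylorMk m p q hp hq)
    rw [relOf_taylorMk] at h1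
    have h2 := congrArg (X.shiftCoeff a b m) h1
    rw [map_smul, shiftCoeff_shiftMon hg, smul_eq_mul, mul_one] at h2
    rw [← h2, freeCoeff, freeCoeff, ← map_sub, ← map_sub]
    rfl
  choose lift h1 h2 h3 using fun f : (X.N a.support b).carrier => exists_nonface f.2
  let k : Finset (Fin (n + 1)) → ℂ := fun f =>
    if hf : f ∈ (X.N a.support b).carrier then - freeCoeff a b φ (ind (f ∪ b)) (lift ⟨f, hf⟩)
    else 0
  have hk : ∀ f hf, k f = - freeCoeff a b φ (ind (f ∪ b)) (lift ⟨f, hf⟩) :=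
    fun f hf => dif_pos hf
  have h1' : ∀ f, (lift f).1 ⊆ (ind (f.1 ∪ b)).support := fun f => by
    rw [support_ind]; exact h1 f
  refine ⟨fun t => k (t.1 0), mem_kerK_zero fun f hf => ?_, ext_ev1 fun f g hf hg hfg => ?_⟩
  · rw [hk f hf.1, freeCoeff_eq_zero hab φ (h1' ⟨f, hf.1⟩) (h3 ⟨f, hf.1⟩ hf)
      (good_ind hf.1.1 hf.1.2.1), neg_zero]
  · have hgood : X.Good a b (ind (f ∪ g ∪ b)) :=
      good_ind hfg (hf.2.1.trans Finset.subset_union_left)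
    have hfle : ind (f ∪ b) ≤ ind (f ∪ g ∪ b) := ind_mono (by grind)
    have hgle : ind (g ∪ b) ≤ ind (f ∪ g ∪ b) := ind_mono (by grind)
    have e := hcoeff (ind (f ∪ g ∪ b)) (lift ⟨f, hf⟩) (lift ⟨g, hg⟩)
      ((h1' ⟨f, hf⟩).trans (support_mono' hfle)) ((h1' ⟨g, hg⟩).trans (support_mono' hgle)) hgood
    rw [h2, h2, freeCoeff_mono φ hfle (h1' ⟨f, hf⟩) (by simp) hgood,
      freeCoeff_mono φ hgle (h1' ⟨g, hg⟩) (by simp) hgood] at e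
    rw [ev1_eq ⟨hf, hg, hfg⟩, dFun_tuple1, ev0_mk _ hf, ev0_mk _ hg, hk f hf, hk g hg]
    refine Eq.trans ?_ e.symm
    ring

/-- The coefficient of `x^{m + a - b}` in the value of `ψ` at `x^{m - p} e_p - x^{m - q} e_q`. -/
def relCoeff (a : Fin (n + 1) →₀ ℕ) (b : Finset (Fin (n + 1))) (ψ : Cotangent.RelHom X.gen)
    (m : Fin (n + 1) →₀ ℕ) (p q : X.Nonface) (hp : p.1 ⊆ m.support) (hq : q.1 ⊆ m.support) : ℂ :=
  X.shiftCoeff a b m (ψ (taylorMk m p q hp hq))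

variable {ψ : Cotangent.RelHom X.gen} {m m' : Fin (n + 1) →₀ ℕ} {p q r : X.Nonface}

theorem relCoeff_add (hp : p.1 ⊆ m.support) (hq : q.1 ⊆ m.support) (hr : r.1 ⊆ m.support) :
    relCoeff a b ψ m p q hp hq + relCoeff a b ψ m q r hq hr = relCoeff a b ψ m p r hp hr := by
  rw [relCoeff, relCoeff, relCoeff, ← map_add, ← map_add, taylorMk_add]

theorem relCoeff_mono (h : m ≤ m') (hp : p.1 ⊆ m.support) (hq : q.1 ⊆ m.support)
    (hp' : p.1 ⊆ m'.support) (hq' : q.1 ⊆ m'.support) (hb : b ⊆ m.support)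
    (hg : X.Good a b m') :
    relCoeff a b ψ m' p q hp' hq' = relCoeff a b ψ m p q hp hq := by
  rw [relCoeff, taylorMk_smul h hp hq, map_smul]
  have := shiftCoeff_monomial_smul (u := m' - m) hb (by rwa [tsub_add_cancel_of_le h])
    (ψ (taylorMk m p q hp hq))
  rwa [tsub_add_cancel_of_le h] at this

/-- The relation is x^{m-s} times a Taylor relation of degree s, and s + a - b has a negative entry
because b is not contained in s. -/
theorem relCoeff_eq_zero_of_subset (hab : Disjoint a.support b) {s : Finset (Fin (n + 1))}
    (hp : p.1 ⊆ m.support) (hq : q.1 ⊆ m.support) (hps : p.1 ⊆ s) (hqs : q.1 ⊆ s)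
    (hs : s ⊆ m.support) (hb : ¬ b ⊆ s) (hg : X.Good a b m) :
    relCoeff a b ψ m p q hp hq = 0 := by
  have hle := ind_le_iff.2 hs
  rw [relCoeff, taylorMk_smul hle (by rwa [support_ind]) (by rwa [support_ind]), map_smul]
  have := shiftCoeff_monomial_smul_eq_zero (m := ind s) (u := m - ind s) hab
    (by rwa [support_ind]) (by rwa [sub_add_ind hs])
    (ψ (taylorMk (ind s) p q (by rwa [support_ind]) (by rwa [support_ind])))
  rwa [sub_add_ind hs] at this

/-- The coefficients of relations between generators not divisible by `x^b` vanish. This is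
where the Koszul relations enter. -/
theorem relCoeff_eq_zero (hab : Disjoint a.support b)
    (hp : p.1 ⊆ m.support) (hq : q.1 ⊆ m.support) (ha : a.support ⊆ m.support)
    (hpb : ¬ b ⊆ p.1) (hqb : ¬ b ⊆ q.1) (hg : X.Good a b m) :
    relCoeff a b ψ m p q hp hq = 0 := by
  have hcp : core a b p.1 ⊆ m.support := core_subset hp ha
  have hcq : core a b q.1 ⊆ m.support := core_subset hq ha
  have hd := Finset.disjoint_left.1 hab
  by_cases hX : core a b p.1 ∪ core a b q.1 ∪ (p.1 ∩ q.1) ∈ X.faces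
  -- The coefficient is moved from m down to m₀ and then up to a common multiple of m₀ and the
  -- Koszul degree p + q. On b an exponent of that multiple exceeds 1 only on p ∩ q, so the shift
  -- has support inside the face of this case. There the relation is a multiple of a Koszul
  -- relation.
  · set m₀ := ind (core a b p.1 ∪ core a b q.1 ∪ b) with hm₀
    have hb₀ : b ⊆ m₀.support := by rw [hm₀, support_ind]; exact Finset.subset_union_right
    have hp₀ : p.1 ⊆ m₀.support := by rw [hm₀, support_ind]; unfold core; grind
    have hq₀ : q.1 ⊆ m₀.support := by rw [hm₀, support_ind]; unfold core; grind
    have hle : m₀ ≤ m := ind_le_iff.2 (Finset.union_subset (Finset.union_subset hcp hcq) hg.1)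
    have hpk : p.1 ⊆ (ind p.1 + ind q.1).support :=
      (support_ind p.1).symm.subset.trans (support_mono' le_self_add)
    have hqk : q.1 ⊆ (ind p.1 + ind q.1).support :=
      (support_ind q.1).symm.subset.trans (support_mono' le_add_self)
    have hg' : X.Good a b (m₀ ⊔ (ind p.1 + ind q.1)) := by
      refine ⟨hb₀.trans (support_mono' le_sup_left), X.down_closed hX fun i hi => ?_⟩
      have hd' := fun h : i ∈ a.support => hd h
      simp only [hm₀, Finsupp.mem_support_iff, Finsupp.coe_tsub, Finsupp.coe_add, Pi.sub_apply,
        Pi.add_apply, ind_apply, core, Finset.mem_union, Finset.mem_sdiff, Finset.mem_inter,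
        Finsupp.sup_apply] at hi hd' ⊢
      grind
    rw [relCoeff_mono hle hp₀ hq₀ hp hq hb₀ hg,
      ← relCoeff_mono le_sup_left hp₀ hq₀ (hp₀.trans (support_mono' le_sup_left))
        (hq₀.trans (support_mono' le_sup_left)) hb₀ hg',
      relCoeff, taylorMk_smul le_sup_right hpk hqk, taylorMk_koszul, smul_zero, map_zero, map_zero]
  -- Otherwise that set is itself a nonface r, and the relation splits as p to r to q. On b the set
  -- r adds nothing beyond p ∩ q, so neither p ∪ r nor q ∪ r contains b, and both summands vanish.
  · let r : X.Nonface := ⟨_, hX⟩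
    have hr : r.1 ⊆ m.support := Finset.union_subset (Finset.union_subset hcp hcq)
      (Finset.inter_subset_left.trans hp)
    have hsub : ∀ i ∈ b, i ∈ r.1 → i ∈ p.1 ∧ i ∈ q.1 := by
      intro i hi hir
      have hd' := fun h : i ∈ a.support => hd h
      simp only [r, core, Finset.mem_union, Finset.mem_sdiff, Finset.mem_inter] at hir
      tauto
    rw [← relCoeff_add hp hr hq,
      relCoeff_eq_zero_of_subset (s := p.1 ∪ r.1) hab hp hr Finset.subset_union_left
        Finset.subset_union_right (Finset.union_subset hp hr)
        (fun h => hpb fun i hi => (Finset.mem_union.1 (h hi)).elim id fun h => (hsub i hi h).1) hg,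
      relCoeff_eq_zero_of_subset (s := q.1 ∪ r.1) hab hr hq Finset.subset_union_right
        Finset.subset_union_left (Finset.union_subset hq hr)
        (fun h => hqb fun i hi => (Finset.mem_union.1 (h hi)).elim id fun h => (hsub i hi h).2) hg,
      add_zero]

theorem relHomDeg_taylorMk (hab : Disjoint a.support b) (hψ : ψ ∈ X.relHomDeg (shift a b))
    (hp : p.1 ⊆ m.support) (hq : q.1 ⊆ m.support) :
    ψ (taylorMk m p q hp hq) = relCoeff a b ψ m p q hp hq • X.shiftMon a b m :=
  eq_shiftCoeff_smul hab (fun _ => rfl) (hψ _ _ (taylor_relDeg m p q hp hq))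

theorem Good.add_left (hg : X.Good a b m) : X.Good a b (a + m) := by
  refine ⟨hg.1.trans (support_mono' le_add_self), X.down_closed hg.2 fun i hi => ?_⟩
  have h := @hg.1 i
  simp only [Finsupp.mem_support_iff, Finsupp.coe_tsub, Finsupp.coe_add, Pi.sub_apply,
    Pi.add_apply, ind_apply] at hi h ⊢
  grind

/-- The cocycle L is read off from ψ at the chosen nonfaces over f and g. For general p and q,
additivity along p, lift(core p), lift(core q), q shows that ψ differs from it by μ_p - μ_q, a
restriction from the free module. -/
theorem relMap_surjective (hab : Disjoint a.support b) :
    Function.Surjective (X.relMap hab) := by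
  classical
  rintro ⟨_, ψ, hψ, rfl⟩
  choose lift h1 h2 h3 using fun f : (X.N a.support b).carrier => exists_nonface f.2
  have hlift : ∀ f (s : Finset (Fin (n + 1))), f.1 ⊆ s → (lift f).1 ⊆ (ind (s ∪ b)).support :=
    fun f s hs => by
      rw [support_ind]; exact (h1 f).trans (Finset.union_subset_union_left hs)
  let L : Finset (Fin (n + 1)) → Finset (Fin (n + 1)) → ℂ := fun f g =>
    if h : f ∈ (X.N a.support b).carrier ∧ g ∈ (X.N a.support b).carrier then
      relCoeff a b ψ (ind (f ∪ g ∪ b)) (lift ⟨f, h.1⟩) (lift ⟨g, h.2⟩)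
        (hlift _ _ Finset.subset_union_left) (hlift _ _ Finset.subset_union_right)
    else 0
  have hL : ∀ (m : Fin (n + 1) →₀ ℕ) f g (hf : f ∈ (X.N a.support b).carrier)
      (hg : g ∈ (X.N a.support b).carrier) (hfm : (lift ⟨f, hf⟩).1 ⊆ m.support)
      (hgm : (lift ⟨g, hg⟩).1 ⊆ m.support), f ⊆ m.support → g ⊆ m.support → X.Good a b m →
      L f g = relCoeff a b ψ m (lift ⟨f, hf⟩) (lift ⟨g, hg⟩) hfm hgm := by
    intro m f g hf hg hfm hgm hfm' hgm' hgood
    refine (dif_pos ⟨hf, hg⟩).trans (relCoeff_mono (ind_le_iff.2 (Finset.union_subset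
      (Finset.union_subset hfm' hgm') hgood.1)) _ _ _ _
      (by rw [support_ind]; exact Finset.subset_union_right) hgood).symm
  have hl : (fun t : (X.N a.support b).Tuple 1 => L (t.1 0) (t.1 1)) ∈ X.Z a b 1 := by
    refine mem_cocycles_one (fun f g hf hg hfg => ?_) fun f g k hf hg hk hfgk => ?_
    · rw [hL (ind (f ∪ g ∪ b)) f g hf.1 hg.1 (hlift _ _ Finset.subset_union_left)
        (hlift _ _ Finset.subset_union_right) (by rw [support_ind]; grind)
        (by rw [support_ind]; grind) (good_ind hfg (hf.1.2.1.trans Finset.subset_union_left))]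
      have ha := hf.1.2.1
      exact relCoeff_eq_zero hab _ _ (by rw [support_ind]; grind) (h3 ⟨f, hf.1⟩ hf)
        (h3 ⟨g, hg.1⟩ hg) (good_ind hfg (hf.1.2.1.trans Finset.subset_union_left))
    · have hgood : X.Good a b (ind (f ∪ (g ∪ k) ∪ b)) :=
        good_ind hfgk (hf.2.1.trans Finset.subset_union_left)
      have hf' : f ⊆ f ∪ (g ∪ k) := by grind
      have hg' : g ⊆ f ∪ (g ∪ k) := by grind
      have hk' : k ⊆ f ∪ (g ∪ k) := by grind
      have hs : f ∪ (g ∪ k) ⊆ (ind (f ∪ (g ∪ k) ∪ b)).support := by rw [support_ind]; grind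
      rw [hL _ f g hf hg (hlift _ _ hf') (hlift _ _ hg') (hf'.trans hs) (hg'.trans hs) hgood,
        hL _ g k hg hk (hlift _ _ hg') (hlift _ _ hk') (hg'.trans hs) (hk'.trans hs) hgood,
        hL _ f k hf hk (hlift _ _ hf') (hlift _ _ hk') (hf'.trans hs) (hk'.trans hs) hgood,
        relCoeff_add]
  have hcl : ∀ p : X.Nonface, p.1 ⊆ (ind (core a b p.1 ∪ b)).support := fun p => by
    rw [support_ind]; unfold core; grind
  -- The correction μ_p compares p with the chosen nonface having the same core.
  let μ : X.Nonface → ℂ := fun p => if hp : core a b p.1 ∈ (X.N a.support b).carrier then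
    relCoeff a b ψ (ind (core a b p.1 ∪ b)) p (lift ⟨_, hp⟩) (hcl p) (hlift _ _ subset_rfl)
    else 0
  have hμ : ∀ (m : Fin (n + 1) →₀ ℕ) (p : X.Nonface) (hp : core a b p.1 ∈ (X.N a.support b).carrier)
      (hpm : p.1 ⊆ m.support) (hpm' : (lift ⟨_, hp⟩).1 ⊆ m.support), core a b p.1 ⊆ m.support →
      X.Good a b m → μ p = relCoeff a b ψ m p (lift ⟨_, hp⟩) hpm hpm' := by
    intro m p hp hpm hpm' hcm hgood
    exact (dif_pos hp).trans (relCoeff_mono (ind_le_iff.2 (Finset.union_subset hcm hgood.1))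
      _ _ _ _ (by simp) hgood).symm
  have hlm : ∀ (m : Fin (n + 1) →₀ ℕ) f, f.1 ⊆ m.support → X.Good a b m →
      (lift f).1 ⊆ m.support := fun m f hf hgood => (h1 f).trans (Finset.union_subset hf hgood.1)
  refine ⟨⟨_, hl⟩, Subtype.ext ?_⟩
  change (LinearMap.range (Cotangent.relRestrict X.gen)).mkQ (relOf hab _) =
    (LinearMap.range (Cotangent.relRestrict X.gen)).mkQ ψ
  rw [Submodule.mkQ_apply, Submodule.mkQ_apply, eq_comm, Submodule.Quotient.eq]
  refine ⟨freeHom a b μ, relHom_ext fun m p q hp hq => ?_⟩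
  rw [relRestrict_freeHom, LinearMap.sub_apply, relOf_taylorMk, relHomDeg_taylorMk hab hψ,
    ← sub_smul]
  · by_cases hg : X.Good a b m
    -- The cores contain a, which the support of m need not. Multiplying by x^a repairs this without
    -- changing the coefficient.
    · have hg' := hg.add_left
      have hle : m ≤ a + m := le_add_self
      have ha : a.support ⊆ (a + m).support := support_mono' le_self_add
      have hp' := hp.trans (support_mono' hle)
      have hq' := hq.trans (support_mono' hle)
      have hpN := hg.core_mem_N hab hp
      have hqN := hg.core_mem_N hab hq
      have hcp := core_subset (b := b) hp' ha
      have hcq := core_subset (b := b) hq' ha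
      have hlp := hlm _ ⟨_, hpN⟩ hcp hg'
      have hlq := hlm _ ⟨_, hqN⟩ hcq hg'
      have hpq : core a b p.1 ∪ core a b q.1 ∈ X.faces := X.down_closed (hg.core_mem hab)
        (Finset.union_subset (core_mono hp) (core_mono hq))
      have e1 := hμ _ p hpN hp' hlp hcp hg'
      have e2 := hμ _ q hqN hq' hlq hcq hg'
      have e3 := hL _ _ _ hpN hqN hlp hlq hcp hcq hg'
      have e4 := relCoeff_mono (ψ := ψ) hle hp hq hp' hq' hg.1 hg'
      have e5 := relCoeff_add (a := a) (b := b) (ψ := ψ) hp' hlp hlq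
      have e6 := relCoeff_add (a := a) (b := b) (ψ := ψ) hp' hq' hlq
      have e7 := ev1_mk L hpN hqN hpq
      refine congrArg (· • X.shiftMon a b m) ?_
      linear_combination e1 - e2 + e3 + e4 + e5 - e6 + e7
    · rw [shiftMon_of_not_good hg, smul_zero, smul_zero]
  · intro p hp hg hb
    have hg' := hg.add_left
    have hp' := hp.trans (support_mono' (le_add_self : m ≤ a + m))
    have ha : a.support ⊆ (a + m).support := support_mono' le_self_add
    have hpN := hg.core_mem_N hab hp
    have hcp := core_subset (b := b) hp' ha
    rw [hμ _ p hpN hp' (hlm _ ⟨_, hpN⟩ hcp hg') hcp hg']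
    exact relCoeff_eq_zero hab _ _ ha hb (h3 ⟨_, hpN⟩ (hg.core_mem_NTilde hab hp hb)) hg'

theorem nonempty_T2Deg_equiv (hab : Disjoint a.support b) :
    Nonempty (X.T2Deg (shift a b) ≃ₗ[ℂ] H (X.NTilde_subset_N a.support b) 1) :=
  ⟨((Submodule.quotEquivOfEq _ _
    (le_antisymm (coboundaries_le_ker hab) (ker_le_coboundaries hab))) ≪≫ₗ
    (X.relMap hab).quotKerEquivOfSurjective (relMap_surjective hab)).symm⟩

end

section

variable {n : ℕ} {X : FaceComplex n} {a : Fin (n + 1) →₀ ℕ} {b : Finset (Fin (n + 1))}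

/-! ### Trivial deformations -/

theorem derivation_monomial (D : Derivation ℂ (P n) (P n)) (m : Fin (n + 1) →₀ ℕ) :
    D (monomial m 1) =
      ∑ i ∈ m.support, monomial (m - Finsupp.single i 1) (m i : ℂ) * D (MvPolynomial.X i) := by
  have hD : D = mkDerivation ℂ fun i => D (MvPolynomial.X i) :=
    derivation_ext fun i => (mkDerivation_X ℂ (fun i => D (MvPolynomial.X i)) i).symm
  conv_lhs => rw [hD]
  rw [mkDerivation_monomial, one_smul]
  rfl

theorem single_eq_ind (i : Fin (n + 1)) : (Finsupp.single i 1 : Fin (n + 1) →₀ ℕ) = ind {i} := by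
  ext j
  simp [Finsupp.single_apply, eq_comm]

/-- A partial derivative contributes to degree `a - b` only if `b ⊆ {i}`. -/
theorem coeff_monomial_mul_of_not_subset (hab : Disjoint a.support b) {m : Fin (n + 1) →₀ ℕ}
    (hb : b ⊆ m.support) {i : Fin (n + 1)} (hi : ¬ b ⊆ {i}) (t : ℂ) (x : P n) :
    coeff (m + a - ind b) (monomial (m - Finsupp.single i 1) t * x) = 0 := by
  rw [coeff_monomial_mul', if_neg]
  intro hle
  obtain ⟨j, hj, hji⟩ := Finset.not_subset.1 hi
  have h1 := hle j
  have h2 := hb hj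
  have h3 : a j = 0 := by
    by_contra h3
    exact Finset.disjoint_left.1 hab (Finsupp.mem_support_iff.2 h3) hj
  have h4 : i ≠ j := fun h => hji (by simp [h])
  simp only [Finsupp.mem_support_iff] at h2
  simp only [Finsupp.coe_tsub, Finsupp.coe_add, Pi.sub_apply, Pi.add_apply, ind_apply, hj,
    if_true, h3, Finsupp.single_eq_of_ne h4.symm] at h1
  omega

theorem homDeg_derToHom (hab : Disjoint a.support b) {D : Derivation ℂ (P n) (P n)}
    (hD : Cotangent.derToHom X.I D ∈ X.homDeg (shift a b)) {m : Fin (n + 1) →₀ ℕ}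
    (hm : m.support ∉ X.faces) : Cotangent.derToHom X.I D (monI m hm) =
      coeff (m + a - ind b) (D (monomial m 1)) • X.shiftMon a b m := by
  rw [homDeg_monI hab hD]
  by_cases hg : X.Good a b m
  · rw [shiftCoeff, if_pos hg]
    exact congrArg (· • X.shiftMon a b m) (X.coeffA_mkQ hg.2 _)
  · rw [shiftMon_of_not_good hg, smul_zero, smul_zero]

/-- D itself need not be homogeneous: only its coefficients in degree m + a - b enter, and there no
partial derivative contributes. -/
theorem derToHom_eq_zero (hab : Disjoint a.support b) {D : Derivation ℂ (P n) (P n)}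
    (hD : Cotangent.derToHom X.I D ∈ X.homDeg (shift a b)) (hb : ∀ i, ¬ b ⊆ {i}) :
    Cotangent.derToHom X.I D = 0 := by
  refine homI_ext fun m hm => ?_
  rw [homDeg_derToHom hab hD, LinearMap.zero_apply]
  by_cases hg : X.Good a b m
  · rw [derivation_monomial, coeff_sum, Finset.sum_eq_zero, zero_smul]
    exact fun i _ => coeff_monomial_mul_of_not_subset hab hg.1 (hb i) _ _
  · rw [shiftMon_of_not_good hg, smul_zero]

theorem mem_trivialDeg {c : Fin (n + 1) → ℤ} {φ : X.I →ₗ[P n] X.A} :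
    φ ∈ X.trivialDeg c ↔ φ ∈ X.homDeg c ∧ ∃ D, Cotangent.derToHom X.I D = φ := by
  rw [trivialDeg, Submodule.mem_inf, Submodule.restrictScalars_mem, Submodule.ker_mkQ,
    LinearMap.mem_range]

theorem homDeg_eq_bot (hab : Disjoint a.support b) (hN : ¬ (X.N a.support b).carrier.Nonempty) :
    X.homDeg (shift a b) = ⊥ := by
  rw [eq_bot_iff]
  intro φ hφ
  refine homI_ext fun m hm => ?_
  rw [homDeg_monI hab hφ, shiftMon_of_not_good fun hg => hN ⟨_, hg.core_mem_N hab
    (p := ⟨_, hm⟩) subset_rfl⟩, smul_zero, LinearMap.zero_apply]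

theorem trivialDeg_eq_bot (hab : Disjoint a.support b)
    (h : ¬ (b.card = 1 ∧ (X.N a.support b).carrier.Nonempty)) :
    X.trivialDeg (shift a b) = ⊥ := by
  rw [eq_bot_iff]
  intro φ hφ
  obtain ⟨hφ, D, rfl⟩ := mem_trivialDeg.1 hφ
  by_cases hN : (X.N a.support b).carrier.Nonempty
  · refine derToHom_eq_zero hab hφ fun i hi => h ⟨?_, hN⟩
    obtain ⟨f, hf⟩ := hN
    rcases Finset.subset_singleton_iff.1 hi with hb | hb
    -- For b = ∅ the conditions f ∈ X and f ∪ b ∉ X contradict each other, so N is empty.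
    · subst hb
      have := hf.2.2.2
      rw [Finset.union_empty] at this
      exact absurd hf.1 this
    · rw [hb, Finset.card_singleton]
  · rwa [homDeg_eq_bot hab hN] at hφ

variable {i : Fin (n + 1)}

/-- The derivation `x^a ∂ / ∂x_i`. -/
def monDer (a : Fin (n + 1) →₀ ℕ) (i : Fin (n + 1)) : Derivation ℂ (P n) (P n) :=
  mkDerivation ℂ (Pi.single i (monomial a 1))

theorem monDer_monomial (m : Fin (n + 1) →₀ ℕ) :
    monDer a i (monomial m 1) = monomial (m - Finsupp.single i 1 + a) (m i : ℂ) := by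
  rw [derivation_monomial, Finset.sum_eq_single i]
  · rw [monDer, mkDerivation_X, Pi.single_eq_same, monomial_mul, mul_one]
  · intro j _ hj
    rw [monDer, mkDerivation_X, Pi.single_eq_of_ne hj, mul_zero]
  · intro h
    rw [Finsupp.notMem_support_iff.1 h, Nat.cast_zero, monomial_zero, zero_mul]

theorem derToHom_monDer (m : Fin (n + 1) →₀ ℕ) (hm : m.support ∉ X.faces) :
    Cotangent.derToHom X.I (monDer a i) (monI m hm) = (m i : ℂ) • X.shiftMon a {i} m := by
  change Submodule.mkQ X.I (monDer a i (monomial m 1)) = _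
  rw [monDer_monomial]
  by_cases hi : i ∈ m.support
  · have hle : Finsupp.single i 1 ≤ m := by
      rw [single_eq_ind]; exact ind_le_iff.2 (by simpa using hi)
    have hE : m - Finsupp.single i 1 + a = m + a - ind {i} := by
      rw [← single_eq_ind, tsub_add_eq_add_tsub hle]
    rw [hE]
    by_cases hg : X.Good a {i} m
    · rw [shiftMon, if_pos hg, ← mul_one (m i : ℂ), ← smul_eq_mul, ← smul_monomial, smul_eq_mul,
        mul_one]
      exact LinearMap.map_smul_of_tower _ _ _
    · rw [shiftMon_of_not_good hg, smul_zero, Submodule.mkQ_apply, Submodule.Quotient.mk_eq_zero]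
      exact X.monomial_mem_I (fun h => hg ⟨by simpa using hi, h⟩) _
  · rw [Finsupp.notMem_support_iff.1 hi, Nat.cast_zero, monomial_zero, map_zero, zero_smul]

theorem derToHom_monDer_mem :
    Cotangent.derToHom X.I (monDer a i) ∈ X.homDeg (shift a {i}) := by
  intro d x hx
  refine sum_monomial_mem_I x ((X.gradedA (d + shift a {i})).comap
    ((Submodule.mkQ X.I).restrictScalars ℂ ∘ₗ (monDer a i).toLinearMap)) fun m hm hmX => ?_
  change Cotangent.derToHom X.I (monDer a i) (monI m hmX) ∈ X.gradedA (d + shift a {i})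
  rw [derToHom_monDer]
  exact Submodule.smul_mem _ _ (shiftMon_mem fun j => (mem_gradedP_iff.1 hx m hm j).symm)

/-- Among the terms of D(x^m) only the one with ∂/∂x_i reaches the degree, and there only the
coefficient of x^a in D(x_i) matters; it does not depend on m. -/
theorem derToHom_eq_smul_monDer (hab : Disjoint a.support {i}) {D : Derivation ℂ (P n) (P n)}
    (hD : Cotangent.derToHom X.I D ∈ X.homDeg (shift a {i})) :
    Cotangent.derToHom X.I D =
      coeff a (D (MvPolynomial.X i)) • Cotangent.derToHom X.I (monDer a i) := by
  refine homI_ext fun m hm => ?_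
  rw [homDeg_derToHom hab hD, LinearMap.smul_apply, derToHom_monDer]
  by_cases hg : X.Good a {i} m
  · have hle : ind {i} ≤ m := ind_le_iff.2 hg.1
    have hE : m + a - ind {i} = m - ind {i} + a := (tsub_add_eq_add_tsub hle).symm
    rw [derivation_monomial, coeff_sum, Finset.sum_eq_single i, single_eq_ind, hE,
      coeff_monomial_mul, mul_comm, mul_smul]
    · exact fun j _ hj => coeff_monomial_mul_of_not_subset hab hg.1 (by simpa using hj.symm) _ _
    · exact fun h => absurd (hg.1 (by simp)) h
  · rw [shiftMon_of_not_good hg, smul_zero, smul_zero, smul_zero]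

theorem finrank_trivialDeg (hab : Disjoint a.support {i})
    (hN : (X.N a.support {i}).carrier.Nonempty) :
    Module.finrank ℂ (X.trivialDeg (shift a {i})) = 1 := by
  have h : X.trivialDeg (shift a {i}) =
      Submodule.span ℂ {Cotangent.derToHom X.I (monDer a i)} := by
    refine le_antisymm (fun φ hφ => ?_) ((Submodule.span_singleton_le_iff_mem _ _).2
      (mem_trivialDeg.2 ⟨derToHom_monDer_mem, _, rfl⟩))
    obtain ⟨hφ, D, rfl⟩ := mem_trivialDeg.1 hφ
    exact Submodule.mem_span_singleton.2 ⟨_, (derToHom_eq_smul_monDer hab hφ).symm⟩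
  rw [h]
  refine finrank_span_singleton fun h0 => ?_
  obtain ⟨f, hf⟩ := hN
  -- The generator is nonzero at x^{f ∪ {i}}: the exponent of x_i is 1 and the shifted monomial is
  -- nonzero.
  have hs : (ind (f ∪ {i})).support ∉ X.faces := by rw [support_ind]; exact hf.2.2.2
  have h1 := LinearMap.congr_fun h0 (monI _ hs)
  rw [derToHom_monDer, LinearMap.zero_apply] at h1
  refine shiftMon_ne_zero (good_ind hf.1 hf.2.1) ((smul_eq_zero.1 h1).resolve_left ?_)
  simp

end

end FaceComplex

end

theorem corollary2p5 {n : ℕ} (X : FaceComplex n) (a : Fin (n + 1) →₀ ℕ)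
    (b : Finset (Fin (n + 1))) (hab : Disjoint a.support b)
    (c : Fin (n + 1) → ℤ) (hc : ∀ i, c i = (a i : ℤ) - FaceComplex.char b i) :
    (∀ k : ℕ, Function.Surjective
      (FaceComplex.USubset.restr (X.NTilde_subset_N a.support b) k)) ∧
    Nonempty (X.homDeg c ≃ₗ[ℂ] FaceComplex.USubset.H (X.NTilde_subset_N a.support b) 0) ∧
    Nonempty (X.T2Deg c ≃ₗ[ℂ] FaceComplex.USubset.H (X.NTilde_subset_N a.support b) 1) ∧
    (b.card = 1 → (X.N a.support b).carrier.Nonempty →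
      Module.finrank ℂ (X.trivialDeg c) = 1) ∧
    (¬ (b.card = 1 ∧ (X.N a.support b).carrier.Nonempty) → X.trivialDeg c = ⊥) := by
  obtain rfl : c = FaceComplex.shift a b := funext hc
  refine ⟨FaceComplex.USubset.restr_surjective _, FaceComplex.nonempty_homDeg_equiv hab,
    FaceComplex.nonempty_T2Deg_equiv hab, fun hb hN => ?_, FaceComplex.trivialDeg_eq_bot hab⟩
  obtain ⟨i, rfl⟩ := Finset.card_eq_one.1 hb
  exact FaceComplex.finrank_trivialDeg hab hN
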